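/- Let $\mathbb D$ be the open unit disc in $\mathbb C$, let $\sigma$ be the normalized Lebesgue measure on the unit circle $\mathbb T$, let $\varphi:\mathbb D\to\mathbb D$ be holomorphic and let $1\le p<\infty$. Let $\omega,\Omega:(0,1]\to(0,+\infty)$ be increasing (not necessarily strictly), and suppose that $\Omega(t)/t^{1-\varepsilon}$ is decreasing (not necessarily strictly) on $(0,1]$ for some $\varepsilon>0$. Put $$\Phi_\Omega(x)=1+\int_x^1\frac{\Omega^2(t)}{t}\,dt,\qquad 0<x\le 1.$$ Assume that $$\int_0^1\frac{\omega^2(t)}{t}\,dt<\infty,\qquad \int_0^1\frac{\Omega^2(t)}{t}\,dt=\infty,$$ and that $$(1-r)\left(\int_{\mathbb T}\left(\frac{|\varphi'(r\zeta)|}{1-|\varphi(r\zeta)|}\,\Omega(1-|\varphi(r\zeta)|)\right)^{2p}d\sigma(\zeta)\right)^{\frac1{2p}}\le\omega(1-r),\qquad 0<r<1.$$ Then $$\sup_{0<r<1}\int_{\mathbb T}\Phi_\Omega^p(1-|\varphi(r\zeta)|)\,d\sigma(\zeta)<\infty.$$ In particular, for $\sigma$-almost every $\zeta\in\mathbb T$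 the radial limit $\varphi^*(\zeta)=\lim_{r\to1-}\varphi(r\zeta)$ exists and $|\varphi^*(\zeta)|<1$; so $\varphi$ is not inner, that is, it is not the case that $|\varphi^*|=1$ $\sigma$-a.e. -/

import Mathlib

open Set Filter Topology MeasureTheory
open scoped ENNReal

noncomputable section

/-- Normalized Lebesgue measure on the unit circle, as a measure on `ℂ` carried by the circle:
the image of `dθ / (2π)` on `(0, 2π]` under `θ ↦ exp (i θ)`. -/
def circleMeasure : Measure ℂ :=
  ENNReal.ofReal (2 * Real.pi)⁻¹ •
    (volume.restrict (Ioc (0 : ℝ) (2 * Real.pi))).map (circleMap 0 1)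

/-- The quadratic integral `∫_x^1 ω(t)² / t dt` of a weight `ω`, with values in `[0, ∞]`.
Its value at `x = 0` is the limit as `x → 0+`. -/
def quadIntegral (ω : ℝ → ℝ) (x : ℝ) : ℝ≥0∞ :=
  ∫⁻ t in Ioo x 1, ENNReal.ofReal (ω t ^ 2 / t)

/-- `Φ_Ω(x) = 1 + ∫_x^1 Ω(t)² / t dt`. -/
def quadPhi (Ω : ℝ → ℝ) (x : ℝ) : ℝ≥0∞ :=
  1 + quadIntegral Ω x

/-- A gauge function on `(0, 1]`: positive there (values elsewhere are irrelevant). -/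
def IsGauge (ω : ℝ → ℝ) : Prop :=
  ∀ t ∈ Ioc (0 : ℝ) 1, 0 < ω t

/-- A holomorphic self-map of the open unit disc. -/
def IsHolSelfMap (φ : ℂ → ℂ) : Prop :=
  DifferentiableOn ℂ φ (Metric.ball 0 1) ∧ MapsTo φ (Metric.ball 0 1) (Metric.ball 0 1)

/-- The weighted hyperbolic derivative `|φ'(z)| Ω(1 - |φ(z)|) / (1 - |φ(z)|)`. -/
def hypDeriv (Ω : ℝ → ℝ) (φ : ℂ → ℂ) (z : ℂ) : ℝ :=
  ‖deriv φ z‖ / (1 - ‖φ z‖) * Ω (1 - ‖φ z‖)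

/-- The integral mean `(∫ |g(rζ)|^q dσ(ζ))^{1/q}` over the unit circle. -/
def integralMean (q : ℝ) (g : ℂ → ℝ) (r : ℝ) : ℝ≥0∞ :=
  (∫⁻ ζ, ENNReal.ofReal |g (r * ζ)| ^ q ∂circleMeasure) ^ (1 / q)

/-- `w` is the radial limit `φ*(ζ) = lim_{r → 1-} φ(rζ)`. -/
def HasRadialLimit (φ : ℂ → ℂ) (ζ w : ℂ) : Prop :=
  Tendsto (fun r : ℝ => φ (r * ζ)) (𝓝[<] 1) (𝓝 w)

/-- An inner function: a holomorphic self-map of the disc whose radial limits have modulus one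
almost everywhere on the circle. -/
def IsInner (φ : ℂ → ℂ) : Prop :=
  IsHolSelfMap φ ∧ ∀ᵐ ζ ∂circleMeasure, ∃ w, HasRadialLimit φ ζ w ∧ ‖w‖ = 1

end

/-! Write Φ for `Φ_Ω` and g for the weighted hyperbolic derivative. The Laplacian of Φ^p(1 - |φ|)
is, heuristically, at most a constant times Φ^(p-1) g². By Hölder, its mean over the circle of
radius r is at most a constant times N^((p-1)/p) (ω(1-r)/(1-r))², where N is the largest mean of Φ^p
up to the radius considered. Integrating twice in log r brings in a weight bounded by log(1/r),
comparable to 1 - r near the boundary, so what accumulates is ∫ ω²(t)/t dt < ∞. Hence N ≤ A + B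
N^((p-1)/p); as the exponent is below one, N ≤ (A + B)^p, uniformly in r.

To differentiate twice, Φ is replaced by a C² function F (`exists_smooth_majorant`,
`exists_rpow_majorant`) and 1 - |φ| by `halfDefect`. The double integration is
`exists_taylor_circularMean`, in the coordinate exp(s + iθ); `exists_circularMean_bound` closes the
estimate.

As Φ(0+) = ∞, Fatou's lemma excludes |φ*| = 1 on a set of positive measure
(`ae_hasRadialLimit_norm_lt_one`). Radial limits exist by `ae_exists_hasRadialLimit`: a primitive of
φ is Lipschitz up to the circle, hence differentiable along it almost everywhere, and a Poisson-type
formula turns this into radial convergence of its derivative φ. -/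

/-! ### A Poisson-type formula for the derivative. -/

section PoissonDerivative

open Metric ComplexConjugate

lemma norm_circleAverage_le {f : ℂ → ℂ} {g : ℂ → ℝ} {c : ℂ} {R : ℝ}
    (hg : CircleIntegrable g c R) (h : ∀ ξ ∈ sphere c |R|, ‖f ξ‖ ≤ g ξ) :
    ‖Real.circleAverage f c R‖ ≤ Real.circleAverage g c R := by
  have hpi : 0 < 2 * Real.pi := Real.two_pi_pos
  rw [Real.circleAverage_def, Real.circleAverage_def, norm_smul, smul_eq_mul,
    Real.norm_of_nonneg (inv_nonneg.2 hpi.le)]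
  refine mul_le_mul_of_nonneg_left ?_ (inv_nonneg.2 hpi.le)
  refine intervalIntegral.norm_integral_le_of_norm_le hpi.le ?_ hg
  exact ae_of_all _ fun θ _ => h _ (circleMap_mem_sphere' c R θ)

lemma sub_ne_zero_of_mem_sphere {z ξ : ℂ} (hz : z ∈ ball (0 : ℂ) 1)
    (hξ : ξ ∈ sphere (0 : ℂ) 1) : ξ - z ≠ 0 := by
  intro h
  rw [sub_eq_zero] at h
  subst h
  simp at hz hξ
  linarith

lemma conj_mul_sub_one_ne_zero {z ξ : ℂ} (hz : z ∈ ball (0 : ℂ) 1)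
    (hξ : ξ ∈ closedBall (0 : ℂ) 1) : conj z * ξ - 1 ≠ 0 := by
  intro h
  have h1 : ‖conj z * ξ‖ = 1 := by rw [sub_eq_zero.1 h]; simp
  rw [norm_mul, RCLike.norm_conj] at h1
  simp at hz hξ
  nlinarith [norm_nonneg z, norm_nonneg ξ]

lemma norm_conj_mul_sub_one {z ξ : ℂ} (hξ : ξ ∈ sphere (0 : ℂ) 1) :
    ‖conj z * ξ - 1‖ = ‖ξ - z‖ := by
  have h1 : ‖ξ‖ = 1 := by simpa using hξ
  have h2 : conj ξ * ξ = 1 := by rw [← Complex.normSq_eq_conj_mul_self, Complex.normSq_eq_norm_sq, h1]; simp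
  have : conj z * ξ - 1 = -(conj (ξ - z) * ξ) := by rw [map_sub, sub_mul, h2]; ring
  rw [this, norm_neg, norm_mul, RCLike.norm_conj, h1, mul_one]

lemma continuousOn_poissonKernel {z : ℂ} (hz : z ∈ ball (0 : ℂ) 1) :
    ContinuousOn (poissonKernel 0 z) (sphere 0 1) := by
  unfold poissonKernel
  refine ContinuousOn.div (by fun_prop) (by fun_prop) fun ξ hξ => ?_
  have := sub_ne_zero_of_mem_sphere hz hξ
  simpa using this

lemma poissonKernel_eq_on_sphere {z ξ : ℂ} (hξ : ξ ∈ sphere (0 : ℂ) 1) :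
    poissonKernel 0 z ξ = (1 - ‖z‖ ^ 2) / ‖ξ - z‖ ^ 2 := by
  have h1 : ‖ξ‖ = 1 := by simpa using hξ
  simp [poissonKernel_def, h1]

lemma circleAverage_poissonKernel {z : ℂ} (hz : z ∈ ball (0 : ℂ) 1) :
    Real.circleAverage (poissonKernel 0 z) 0 1 = 1 := by
  have h := (diffContOnCl_const (𝕜 := ℂ) (c := (1 : ℂ)) (s := ball (0 : ℂ) 1)).circleAverage_poissonKernel_smul hz
  have hi : CircleIntegrable (poissonKernel 0 z) 0 1 :=
    (continuousOn_poissonKernel hz).circleIntegrable zero_le_one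
  have h2 := Complex.ofRealCLM.circleAverage_comp_comm hi
  have h3 : (⇑Complex.ofRealCLM ∘ poissonKernel 0 z) = poissonKernel 0 z • fun _ => (1 : ℂ) := by
    ext ξ; simp
  rw [h3, h] at h2
  exact (by simpa using h2.symm)

/-- On the unit circle ξ⁻¹ is the conjugate of ξ, so (ξ - z)⁻¹ is the conjugate of `g`, which is
holomorphic on the closed disc and therefore reproduced by the Poisson kernel. -/
lemma circleAverage_poissonKernel_inv_sub {z : ℂ} (hz : z ∈ ball (0 : ℂ) 1) :
    Real.circleAverage (poissonKernel 0 z • fun ξ => (ξ - z)⁻¹) 0 1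
      = conj z / (1 - conj z * z) := by
  set g : ℂ → ℂ := fun ξ => ξ / (1 - conj z * ξ) with hg
  have hne : ∀ ξ ∈ closedBall (0 : ℂ) 1, 1 - conj z * ξ ≠ 0 := fun ξ hξ h =>
    conj_mul_sub_one_ne_zero hz hξ (by linear_combination -h)
  have hd : DiffContOnCl ℂ g (ball 0 1) := by
    refine DifferentiableOn.diffContOnCl ?_
    rw [closure_ball _ one_ne_zero]
    exact DifferentiableOn.div (by fun_prop) (by fun_prop) hne
  have h1 := hd.circleAverage_poissonKernel_smul hz
  have hi : CircleIntegrable (poissonKernel 0 z • g) 0 1 := by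
    refine ContinuousOn.circleIntegrable zero_le_one ?_
    exact (continuousOn_poissonKernel hz).smul (hd.continuousOn_ball.mono sphere_subset_closedBall)
  have h2 := (Complex.conjCLE : ℂ →L[ℝ] ℂ).circleAverage_comp_comm hi
  rw [h1] at h2
  have h3 : Real.circleAverage (poissonKernel 0 z • fun ξ => (ξ - z)⁻¹) 0 1
      = Real.circleAverage (⇑(Complex.conjCLE : ℂ →L[ℝ] ℂ) ∘ (poissonKernel 0 z • g)) 0 1 := by
    refine Real.circleAverage_congr_sphere fun ξ hξ => ?_
    rw [abs_one] at hξ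
    have hξ1 : ‖ξ‖ = 1 := by simpa using hξ
    have h4 : ξ * conj ξ = 1 := by
      rw [Complex.mul_conj, Complex.normSq_eq_norm_sq, hξ1]; simp
    have h5 : conj ξ ≠ 0 := right_ne_zero_of_mul_eq_one h4
    have h6 := sub_ne_zero_of_mem_sphere hz hξ
    have h7 : 1 - z * conj ξ ≠ 0 := by
      rw [← h4, ← sub_mul]; exact mul_ne_zero h6 h5
    simp only [Pi.smul_apply', Function.comp_apply, hg, ContinuousLinearEquiv.coe_coe,
      Complex.conjCLE_apply, Complex.real_smul, map_mul, map_div₀, map_sub, map_one,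
      Complex.conj_conj, Complex.conj_ofReal]
    congr 1
    rw [inv_eq_one_div, div_eq_div_iff h6 h7]
    linear_combination h4 * (-1)
  rw [h3, h2]
  simp [hg, mul_comm]

/-- The derivative of a holomorphic function as an average over the boundary circle against a
kernel whose product with `|ξ - z|` is comparable to the Poisson kernel. -/
lemma deriv_eq_circleAverage {E : ℂ → ℂ} {z : ℂ} (hE : DiffContOnCl ℂ E (ball 0 1))
    (hz : z ∈ ball (0 : ℂ) 1) :
    deriv E z = Real.circleAverage
      (poissonKernel 0 z • fun ξ => E ξ * ((ξ - z)⁻¹ + conj z / (conj z * ξ - 1))) 0 1 := by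
  have hcl : closure (ball (0 : ℂ) 1) = closedBall 0 1 := closure_ball _ one_ne_zero
  have hnhds : closedBall (0 : ℂ) 1 ∈ 𝓝 z :=
    mem_of_superset (isOpen_ball.mem_nhds hz) ball_subset_closedBall
  have hEz : DifferentiableAt ℂ E z := hE.differentiableAt isOpen_ball hz
  have d1 : DiffContOnCl ℂ (dslope E z) (ball 0 1) := by
    refine ⟨(Complex.differentiableOn_dslope (isOpen_ball.mem_nhds hz)).2 hE.differentiableOn, ?_⟩
    rw [hcl]
    exact (continuousOn_dslope hnhds).2 ⟨hE.continuousOn_ball, hEz⟩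
  have dq : DiffContOnCl ℂ (fun ξ => conj z / (conj z * ξ - 1)) (ball 0 1) := by
    refine DifferentiableOn.diffContOnCl ?_
    rw [hcl]
    exact DifferentiableOn.div (by fun_prop) (by fun_prop)
      fun ξ hξ => conj_mul_sub_one_ne_zero hz hξ
  have d3 : DiffContOnCl ℂ (fun ξ => E ξ * (conj z / (conj z * ξ - 1))) (ball 0 1) := hE.smul dq
  have hP := continuousOn_poissonKernel hz
  have hss : sphere (0 : ℂ) 1 ⊆ closedBall 0 1 := sphere_subset_closedBall
  have i1 : CircleIntegrable (poissonKernel 0 z • dslope E z) 0 1 :=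
    (hP.smul (d1.continuousOn_ball.mono hss)).circleIntegrable zero_le_one
  have i3 : CircleIntegrable
      (poissonKernel 0 z • fun ξ => E ξ * (conj z / (conj z * ξ - 1))) 0 1 :=
    (hP.smul (d3.continuousOn_ball.mono hss)).circleIntegrable zero_le_one
  have ci : ContinuousOn (fun ξ : ℂ => (ξ - z)⁻¹) (sphere 0 1) :=
    ContinuousOn.inv₀ (by fun_prop) fun ξ hξ => sub_ne_zero_of_mem_sphere hz hξ
  have i2 : CircleIntegrable (poissonKernel 0 z • fun ξ => (ξ - z)⁻¹) 0 1 :=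
    (hP.smul ci).circleIntegrable zero_le_one
  have i2' : CircleIntegrable (E z • poissonKernel 0 z • fun ξ => (ξ - z)⁻¹) 0 1 :=
    ((hP.smul ci).const_smul (E z)).circleIntegrable zero_le_one
  -- Split E = (E - E z) + E z against (ξ - z)⁻¹. The difference quotient reproduces E' z; the two
  -- remaining terms, both multiples of E z, have opposite averages.
  have e : Real.circleAverage
      (poissonKernel 0 z • fun ξ => E ξ * ((ξ - z)⁻¹ + conj z / (conj z * ξ - 1))) 0 1
      = Real.circleAverage (poissonKernel 0 z • dslope E z
        + (poissonKernel 0 z • fun ξ => E ξ * (conj z / (conj z * ξ - 1)))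
        + E z • poissonKernel 0 z • fun ξ => (ξ - z)⁻¹) 0 1 := by
    refine Real.circleAverage_congr_sphere fun ξ hξ => ?_
    rw [abs_one] at hξ
    have h6 := sub_ne_zero_of_mem_sphere hz hξ
    simp only [Pi.smul_apply', Pi.add_apply, Pi.smul_apply, Complex.real_smul, smul_eq_mul]
    rw [dslope_of_ne _ (sub_ne_zero.1 h6), slope_def_field]
    field_simp
    ring
  rw [e, Real.circleAverage_add (i1.add i3) i2', Real.circleAverage_add i1 i3,
    Real.circleAverage_smul, d1.circleAverage_poissonKernel_smul hz,
    d3.circleAverage_poissonKernel_smul hz, circleAverage_poissonKernel_inv_sub hz, dslope_same]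
  have hne := conj_mul_sub_one_ne_zero hz (ball_subset_closedBall hz)
  have hne' : 1 - conj z * z ≠ 0 := fun h => hne (by linear_combination -h)
  simp only [smul_eq_mul]
  field_simp
  ring

end PoissonDerivative

/-! ### Existence of radial limits almost everywhere. -/

section RadialLimits

open Metric ComplexConjugate

/-- The kernel is at most 2P/|ξ - z|, with P the Poisson kernel, and |ξ - ζ| ≤ 2|ξ - z|. Near ζ this
leaves 4ηP, of average 4η. Far from ζ, |ξ - z| ≥ τ/2 and P ≤ 8(1 - r)/τ², which gives the second
term. -/
lemma norm_deriv_le_of_boundary_bound {E : ℂ → ℂ} {ζ : ℂ} {r η τ B : ℝ}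
    (hE : DiffContOnCl ℂ E (ball 0 1)) (hζ : ζ ∈ sphere (0 : ℂ) 1) (hr : r ∈ Ioo (0 : ℝ) 1)
    (hη : 0 ≤ η) (hτ : 0 < τ) (hB : ∀ ξ ∈ sphere (0 : ℂ) 1, ‖E ξ‖ ≤ B)
    (hnear : ∀ ξ ∈ sphere (0 : ℂ) 1, ‖ξ - ζ‖ < τ → ‖E ξ‖ ≤ η * ‖ξ - ζ‖) :
    ‖deriv E (r * ζ)‖ ≤ 4 * η + 32 * B * (1 - r) / τ ^ 3 := by
  have hζ1 : ‖ζ‖ = 1 := by simpa using hζ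
  have hB0 : 0 ≤ B := (norm_nonneg _).trans (hB ζ hζ)
  set z : ℂ := r * ζ with hzdef
  have hznorm : ‖z‖ = r := by simp [hzdef, hζ1, abs_of_pos hr.1]
  have hz : z ∈ ball (0 : ℂ) 1 := by simpa [hznorm] using hr.2
  have hδ : 0 < 1 - r := by linarith [hr.2]
  have hP := continuousOn_poissonKernel hz
  have hc : ContinuousOn (fun ξ => 4 * η * poissonKernel 0 z ξ + 32 * B * (1 - r) / τ ^ 3)
      (sphere 0 1) := (hP.const_mul _).add continuousOn_const
  rw [deriv_eq_circleAverage hE hz]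
  have h1 := (norm_circleAverage_le
    (f := poissonKernel 0 z • fun ξ => E ξ * ((ξ - z)⁻¹ + conj z / (conj z * ξ - 1)))
    (hc.circleIntegrable zero_le_one) ?_)
  · refine h1.trans ?_
    rw [Real.circleAverage_fun_add ((hP.const_mul _).circleIntegrable zero_le_one)
      (continuousOn_const.circleIntegrable zero_le_one), Real.circleAverage_const]
    have : (fun ξ => 4 * η * poissonKernel 0 z ξ) = (4 * η) • poissonKernel 0 z := by
      ext ξ; simp
    rw [this, Real.circleAverage_smul, circleAverage_poissonKernel hz]
    simp
  · intro ξ hξ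
    rw [abs_one] at hξ
    have hξ1 : ‖ξ‖ = 1 := by simpa using hξ
    have ha : 0 < ‖ξ - z‖ := norm_pos_iff.2 (sub_ne_zero_of_mem_sphere hz hξ)
    have hzζ : ‖z - ζ‖ = 1 - r := by
      have : z - ζ = ((r - 1 : ℝ) : ℂ) * ζ := by rw [hzdef]; push_cast; ring
      rw [this, norm_mul, hζ1, mul_one, Complex.norm_real, Real.norm_eq_abs,
        abs_of_neg (by linarith)]
      ring
    have hδa : 1 - r ≤ ‖ξ - z‖ := by
      have := norm_sub_norm_le ξ z
      rw [hξ1, hznorm] at this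
      exact this
    have hζa : ‖ξ - ζ‖ ≤ 2 * ‖ξ - z‖ := by
      have := norm_sub_le_norm_sub_add_norm_sub ξ z ζ
      linarith
    have hsum : ‖(ξ - z)⁻¹ + conj z / (conj z * ξ - 1)‖ ≤ 2 / ‖ξ - z‖ := by
      refine (norm_add_le _ _).trans ?_
      rw [norm_inv, norm_div, norm_conj_mul_sub_one hξ, RCLike.norm_conj, hznorm]
      rw [inv_eq_one_div, ← add_div]
      gcongr
      linarith [hr.2]
    have hP0 : 0 ≤ poissonKernel 0 z ξ := by
      rw [poissonKernel_eq_on_sphere hξ, hznorm]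
      have : 0 ≤ 1 - r ^ 2 := by nlinarith [hr.1, hr.2]
      positivity
    have hmain : ‖(poissonKernel 0 z • fun ξ => E ξ * ((ξ - z)⁻¹ + conj z / (conj z * ξ - 1))) ξ‖
        ≤ poissonKernel 0 z ξ * (‖E ξ‖ * (2 / ‖ξ - z‖)) := by
      simp only [Pi.smul_apply']
      rw [norm_smul, norm_mul, Real.norm_of_nonneg hP0]
      gcongr
    refine hmain.trans ?_
    by_cases hn : ‖ξ - ζ‖ < τ
    · have h2 : ‖E ξ‖ * (2 / ‖ξ - z‖) ≤ 4 * η := by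
        rw [mul_div_assoc', div_le_iff₀ ha]
        nlinarith [hnear ξ hξ hn]
      have h3 : 0 ≤ 32 * B * (1 - r) / τ ^ 3 := by positivity
      nlinarith [mul_le_mul_of_nonneg_left h2 hP0]
    · have hτa : τ / 2 ≤ ‖ξ - z‖ := by linarith [not_lt.1 hn]
      have h2 : ‖E ξ‖ * (2 / ‖ξ - z‖) ≤ B * (2 / (τ / 2)) := by
        gcongr
        exact hB ξ hξ
      have h3 : poissonKernel 0 z ξ ≤ (2 * (1 - r)) / (τ / 2) ^ 2 := by
        rw [poissonKernel_eq_on_sphere hξ, hznorm]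
        gcongr
        nlinarith [hr.1, hr.2]
      have h4 : 0 ≤ 4 * η * poissonKernel 0 z ξ := by positivity
      calc _ ≤ (2 * (1 - r)) / (τ / 2) ^ 2 * (B * (2 / (τ / 2))) := by gcongr
        _ = 32 * B * (1 - r) / τ ^ 3 := by field_simp; ring
        _ ≤ _ := by linarith

lemma exists_angle_of_mem_sphere {ξ : ℂ} (hξ : ‖ξ‖ = 1) (θ : ℝ) :
    ∃ t : ℝ, ξ = circleMap 0 1 (θ + t) ∧ |t| ≤ Real.pi / 2 * ‖ξ - circleMap 0 1 θ‖ := by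
  set ζ := circleMap 0 1 θ with hζdef
  have hζ : ‖ζ‖ = 1 := by simp [hζdef]
  have hζ0 : ζ ≠ 0 := norm_ne_zero_iff.1 (by rw [hζ]; exact one_ne_zero)
  have hξ0 : ξ ≠ 0 := norm_ne_zero_iff.1 (by rw [hξ]; exact one_ne_zero)
  refine ⟨(ξ / ζ).arg, ?_, ?_⟩
  · have h := Complex.norm_mul_exp_arg_mul_I (ξ / ζ)
    rw [norm_div, hξ, hζ, div_one, Complex.ofReal_one, one_mul] at h
    have h2 : circleMap 0 1 (θ + (ξ / ζ).arg) = ζ * Complex.exp ((ξ / ζ).arg * Complex.I) := by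
      simp [hζdef, circleMap, add_mul, Complex.exp_add]
    rw [h2, h, mul_div_cancel₀ _ hζ0]
  · rw [← Complex.angle_eq_abs_arg hξ0 hζ0]
    exact Complex.angle_le_mul_norm_sub hξ hζ

/-- Subtracting the affine function with the same value and tangential derivative at ζ leaves an
error E = o(|ξ - ζ|) on the circle, and `norm_deriv_le_of_boundary_bound` gives E' → 0 along the
radius. -/
lemma deriv_tendsto_of_boundary_differentiableAt {G : ℂ → ℂ} {θ : ℝ}
    (hG : DiffContOnCl ℂ G (ball 0 1))
    (hθ : DifferentiableAt ℝ (fun t : ℝ => G (circleMap 0 1 t)) θ) :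
    ∃ w, Tendsto (fun r : ℝ => deriv G (r * circleMap 0 1 θ)) (𝓝[<] 1) (𝓝 w) := by
  set ζ := circleMap 0 1 θ with hζdef
  have hζ : ‖ζ‖ = 1 := by simp [hζdef]
  have hζs : ζ ∈ sphere (0 : ℂ) 1 := by simpa using hζ
  have hζ0 : ζ ≠ 0 := norm_ne_zero_iff.1 (by rw [hζ]; exact one_ne_zero)
  -- Along the circle, d/dθ is iζ d/dξ at ζ.
  set c : ℂ := deriv (fun t : ℝ => G (circleMap 0 1 t)) θ / (ζ * Complex.I) with hc
  set E : ℂ → ℂ := fun ξ => G ξ - (G ζ + c * (ξ - ζ)) with hEdef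
  have hE : DiffContOnCl ℂ E (ball 0 1) := by
    refine hG.sub (DifferentiableOn.diffContOnCl (by fun_prop))
  have hder : HasDerivAt (fun t : ℝ => E (circleMap 0 1 t)) 0 θ := by
    have h1 := (hasDerivAt_circleMap 0 1 θ)
    have h2 := hθ.hasDerivAt.sub
      (((h1.sub_const ζ).const_mul c).const_add (G ζ))
    have h3 : deriv (fun t : ℝ => G (circleMap 0 1 t)) θ - c * (circleMap 0 1 θ * Complex.I) = 0 := by
      rw [hc, ← hζdef, div_mul_cancel₀ _ (mul_ne_zero hζ0 Complex.I_ne_zero), sub_self]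
    rw [h3] at h2
    exact h2
  have hE0 : E ζ = 0 := by simp [hEdef]
  have hbd : ∃ B, ∀ ξ ∈ sphere (0 : ℂ) 1, ‖E ξ‖ ≤ B :=
    (isCompact_sphere 0 1).exists_bound_of_continuousOn
      (hE.continuousOn_ball.mono sphere_subset_closedBall)
  obtain ⟨B, hB⟩ := hbd
  refine ⟨c, ?_⟩
  have hsub : ∀ᶠ r : ℝ in 𝓝[<] 1, deriv G (r * ζ) - c = deriv E (r * ζ) ∧ r ∈ Ioo (0 : ℝ) 1 := by
    filter_upwards [Ioo_mem_nhdsLT (zero_lt_one' ℝ)] with r hr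
    refine ⟨?_, hr⟩
    have hz : (r : ℂ) * ζ ∈ ball (0 : ℂ) 1 := by simp [hζ, abs_of_pos hr.1, hr.2]
    have h1 := (hG.differentiableAt isOpen_ball hz).hasDerivAt
    have h2 : HasDerivAt (fun ξ => G ζ + c * (ξ - ζ)) c ((r : ℂ) * ζ) := by
      simpa using (((hasDerivAt_id ((r : ℂ) * ζ)).sub_const ζ).const_mul c).const_add (G ζ)
    exact (h1.sub h2).deriv.symm
  rw [tendsto_iff_norm_sub_tendsto_zero]
  rw [Metric.tendsto_nhds]
  intro e he
  set η := e / 16 with hη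
  have hηpos : 0 < η := by positivity
  have hlo := Asymptotics.isLittleO_iff.1 hder.isLittleO (show 0 < η / (Real.pi / 2) by positivity)
  obtain ⟨τ', hτ', hτ'b⟩ := Metric.eventually_nhds_iff.1 hlo
  -- `τ'` bounds the angle and `τ` the chord; an arc is at most π/2 times its chord.
  set τ := τ' / (Real.pi / 2) with hτ
  have hτpos : 0 < τ := by positivity
  have hnear : ∀ ξ ∈ sphere (0 : ℂ) 1, ‖ξ - ζ‖ < τ → ‖E ξ‖ ≤ η * ‖ξ - ζ‖ := by
    intro ξ hξ hlt
    obtain ⟨t, ht, htb⟩ := exists_angle_of_mem_sphere (by simpa using hξ) θ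
    have h1 : |t| < τ' := by
      refine htb.trans_lt ?_
      rw [hτ, lt_div_iff₀ (by positivity)] at hlt
      rwa [mul_comm]
    have h2 := hτ'b (y := θ + t) (by simpa [dist_eq_norm] using h1)
    have h3 : circleMap 0 1 θ = ζ := rfl
    simp only [← ht, h3, hE0, smul_zero, sub_zero, add_sub_cancel_left] at h2
    refine h2.trans ?_
    rw [Real.norm_eq_abs]
    calc η / (Real.pi / 2) * |t| ≤ η / (Real.pi / 2) * (Real.pi / 2 * ‖ξ - ζ‖) := by gcongr
      _ = η * ‖ξ - ζ‖ := by field_simp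
  have hlim : Tendsto (fun r : ℝ => 4 * η + 32 * B * (1 - r) / τ ^ 3) (𝓝[<] 1)
      (𝓝 (4 * η + 32 * B * (1 - 1) / τ ^ 3)) :=
    Tendsto.mono_left (Continuous.tendsto (by fun_prop) 1) nhdsWithin_le_nhds
  have hlt : 4 * η + 32 * B * (1 - 1) / τ ^ 3 < e := by
    rw [hη]; simp; linarith
  filter_upwards [hlim.eventually_lt_const hlt, hsub] with r hr1 hr2
  rw [hr2.1, dist_zero_right, norm_norm]
  exact (norm_deriv_le_of_boundary_bound hE hζs hr2.2 hηpos.le hτpos hB hnear).trans_lt hr1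

/-- **Fatou's theorem** on radial limits of a holomorphic self-map of the disc. -/
theorem ae_exists_hasRadialLimit {φ : ℂ → ℂ} (hφ : IsHolSelfMap φ) :
    ∀ᵐ θ : ℝ, ∃ w, HasRadialLimit φ (circleMap 0 1 θ) w := by
  obtain ⟨G₀, hG₀⟩ := hφ.1.isExactOn_ball
  have hlip₀ : LipschitzOnWith 1 G₀ (ball 0 1) := by
    refine Convex.lipschitzOnWith_of_nnnorm_deriv_le (𝕜 := ℂ)
      (fun z hz => (hG₀ z hz).differentiableAt) (fun z hz => ?_) (convex_ball 0 1)
    rw [(hG₀ z hz).deriv]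
    have h : φ z ∈ ball (0 : ℂ) 1 := hφ.2 hz
    rw [mem_ball_zero_iff] at h
    exact h.le
  -- Outside the disc only the Lipschitz property of `G` matters: it gives continuity up to the
  -- circle and differentiability in θ almost everywhere.
  obtain ⟨G, hG, hGeq⟩ := hlip₀.extend_finite_dimension
  have hder : ∀ z ∈ ball (0 : ℂ) 1, HasDerivAt G (φ z) z := fun z hz =>
    (hG₀ z hz).congr_of_eventuallyEq (hGeq.symm.eventuallyEq_of_mem (isOpen_ball.mem_nhds hz))
  have hdc : DiffContOnCl ℂ G (ball 0 1) :=
    ⟨fun z hz => (hder z hz).differentiableAt.differentiableWithinAt, hG.continuous.continuousOn⟩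
  filter_upwards [(hG.comp (lipschitzWith_circleMap 0 1)).ae_differentiableAt_real] with θ hθ
  obtain ⟨w, hw⟩ := deriv_tendsto_of_boundary_differentiableAt hdc hθ
  refine ⟨w, hw.congr' ?_⟩
  filter_upwards [Ioo_mem_nhdsLT (zero_lt_one' ℝ)] with r hr
  exact (hder _ (by simp [abs_of_pos hr.1, hr.2])).deriv

end RadialLimits

/-! ### Regularity of Ω and a smooth substitute for Φ. -/

section Weight

variable {Ω : ℝ → ℝ}

/-- The regularity of Ω enters the later arguments only through this consequence, which yields both
continuity and the doubling bound Ω(x) ≤ 2Ω(x/2). -/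
lemma IsGauge.div_antitoneOn {ε : ℝ} (hΩ : IsGauge Ω) (hε : 0 < ε)
    (h : AntitoneOn (fun t : ℝ => Ω t / t ^ (1 - ε)) (Ioc 0 1)) :
    AntitoneOn (fun t : ℝ => Ω t / t) (Ioc 0 1) := by
  have key : ∀ t ∈ Ioc (0 : ℝ) 1, Ω t / t = Ω t / t ^ (1 - ε) * t ^ (-ε) := by
    intro t ht
    rw [Real.rpow_sub ht.1, Real.rpow_one, Real.rpow_neg ht.1.le]
    have := Real.rpow_pos_of_pos ht.1 ε
    field_simp
  intro s hs t ht hst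
  simp only [key s hs, key t ht]
  refine mul_le_mul (h hs ht hst) ?_ (Real.rpow_nonneg ht.1.le _) ?_
  · exact Real.rpow_le_rpow_of_nonpos hs.1 hst (by linarith)
  · exact div_nonneg (hΩ s hs).le (Real.rpow_nonneg hs.1.le _)

lemma continuousOn_of_monotoneOn_of_div_antitoneOn (hmono : MonotoneOn Ω (Ioc 0 1))
    (hanti : AntitoneOn (fun t : ℝ => Ω t / t) (Ioc 0 1)) : ContinuousOn Ω (Ioc 0 1) := by
  intro x hx
  have key : ∀ s ∈ Ioc (0 : ℝ) 1, ∀ t ∈ Ioc (0 : ℝ) 1, s ≤ t → Ω t ≤ Ω s * (t / s) := by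
    intro s hs t ht hst
    have := hanti hs ht hst
    simp only at this
    rw [div_le_iff₀ ht.1] at this
    calc Ω t ≤ Ω s / s * t := this
      _ = _ := by ring
  have hx0 := hx.1
  have hl : Tendsto (fun t : ℝ => min (Ω x) (Ω x * (t / x))) (𝓝[Ioc 0 1] x) (𝓝 (Ω x)) := by
    have : ContinuousAt (fun t : ℝ => min (Ω x) (Ω x * (t / x))) x := by fun_prop
    have h := this.tendsto
    simp only [div_self hx0.ne', mul_one, min_self] at h
    exact h.mono_left nhdsWithin_le_nhds
  have hu : Tendsto (fun t : ℝ => max (Ω x) (Ω x * (t / x))) (𝓝[Ioc 0 1] x) (𝓝 (Ω x)) := by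
    have : ContinuousAt (fun t : ℝ => max (Ω x) (Ω x * (t / x))) x := by fun_prop
    have h := this.tendsto
    simp only [div_self hx0.ne', mul_one, max_self] at h
    exact h.mono_left nhdsWithin_le_nhds
  refine tendsto_of_tendsto_of_tendsto_of_le_of_le' hl hu ?_ ?_
  · filter_upwards [self_mem_nhdsWithin] with t ht
    rcases le_total x t with h | h
    · exact (min_le_left _ _).trans (hmono hx ht h)
    · refine (min_le_right _ _).trans ?_
      have := key t ht x hx h
      have ht0 := ht.1
      calc Ω x * (t / x) ≤ Ω t * (x / t) * (t / x) := by
            have : 0 ≤ t / x := by positivity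
            gcongr
        _ = Ω t := by field_simp
  · filter_upwards [self_mem_nhdsWithin] with t ht
    rcases le_total x t with h | h
    · exact (key x hx t ht h).trans (le_max_right _ _)
    · exact (hmono ht hx h).trans (le_max_left _ _)

/-- `Φ_Ω` has a majorant (up to a constant) which is twice continuously differentiable, with the
bounds on its first two derivatives that `Φ_Ω` itself would satisfy. -/
lemma exists_smooth_majorant (hpos : IsGauge Ω) (hmono : MonotoneOn Ω (Ioc 0 1))
    (hanti : AntitoneOn (fun t : ℝ => Ω t / t) (Ioc 0 1)) :
    ∃ F h h' : ℝ → ℝ, ContinuousOn h' (Ioo 0 1) ∧ ∀ x ∈ Ioo (0 : ℝ) 1,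
      HasDerivAt F (-h x) x ∧ HasDerivAt h (h' x) x ∧ 1 ≤ F x ∧ 0 ≤ h x ∧ h x ≤ Ω x ^ 2 / x ∧
      |h' x| ≤ Ω x ^ 2 / x ^ 2 ∧ quadPhi Ω x ≤ ENNReal.ofReal (8 * F x) := by
  have hcont := continuousOn_of_monotoneOn_of_div_antitoneOn hmono hanti
  have hsqmono : MonotoneOn (fun t => Ω t ^ 2) (Ioc 0 1) := fun s hs t ht hst =>
    pow_le_pow_left₀ (hpos s hs).le (hmono hs ht hst) 2
  have hint : IntegrableOn (fun t => Ω t ^ 2) (Ioc 0 1) := by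
    refine Integrable.of_bound
      ((hcont.pow 2).aestronglyMeasurable measurableSet_Ioc) (Ω 1 ^ 2) ?_
    filter_upwards [ae_restrict_mem measurableSet_Ioc] with t ht
    rw [Real.norm_of_nonneg (sq_nonneg _)]
    exact hsqmono ht ⟨zero_lt_one, le_rfl⟩ ht.2
  have hsub : ∀ a b : ℝ, 0 ≤ a → a ≤ b → b ≤ 1 →
      IntervalIntegrable (fun t => Ω t ^ 2) volume a b := fun a b ha hab hb =>
    (intervalIntegrable_iff_integrableOn_Ioc_of_le hab).2 (hint.mono_set (Ioc_subset_Ioc ha hb))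
  -- Ω need not be differentiable, so Ω²(x)/x is replaced by `J x / x ^ 2`, which is C¹ and
  -- comparable to it.
  set J : ℝ → ℝ := fun x => ∫ t in (0 : ℝ)..x, Ω t ^ 2 with hJ
  have hJcont : ContinuousOn J (Icc 0 1) := by
    refine intervalIntegral.continuousOn_primitive_interval' (b₁ := 0) (b₂ := 1) (a := 0) (hsub 0 1 le_rfl zero_le_one le_rfl) ?_ |>.mono ?_
    · simp
    · simp
  have hJ0 : ∀ x ∈ Ioc (0 : ℝ) 1, 0 ≤ J x := fun x hx =>
    intervalIntegral.integral_nonneg hx.1.le fun _ _ => sq_nonneg _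
  have hJle : ∀ x ∈ Ioc (0 : ℝ) 1, J x ≤ x * Ω x ^ 2 := by
    intro x hx
    have := intervalIntegral.integral_mono_on_of_le_Ioo hx.1.le (hsub 0 x le_rfl hx.1.le hx.2)
      (intervalIntegrable_const (c := Ω x ^ 2))
      (fun t ht => hsqmono ⟨ht.1, ht.2.le.trans hx.2⟩ hx ht.2.le)
    simpa using this
  -- The upper half of (0, x) alone contributes (x/2) Ω(x/2)², and doubling costs a factor 4; hence
  -- 8.
  have hJge : ∀ x ∈ Ioc (0 : ℝ) 1, x * Ω x ^ 2 ≤ 8 * J x := by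
    intro x hx
    have hx2 : x / 2 ∈ Ioc (0 : ℝ) 1 := ⟨by linarith [hx.1], by linarith [hx.1, hx.2]⟩
    have h1 := intervalIntegral.integral_mono_on_of_le_Ioo (a := x / 2) (b := x)
      (by linarith [hx.1]) (intervalIntegrable_const (c := Ω (x / 2) ^ 2))
      (hsub (x / 2) x hx2.1.le (by linarith [hx.1]) hx.2)
      (fun t ht => hsqmono hx2 ⟨hx2.1.trans ht.1, ht.2.le.trans hx.2⟩ ht.1.le)
    have h2 := intervalIntegral.integral_add_adjacent_intervals
      (hsub 0 (x / 2) le_rfl hx2.1.le hx2.2) (hsub (x / 2) x hx2.1.le (by linarith [hx.1]) hx.2)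
    have h3 := hJ0 (x / 2) hx2
    have h4 : Ω x ≤ 2 * Ω (x / 2) := by
      have := hanti hx2 hx (by linarith [hx.1])
      simp only at this
      rw [div_le_div_iff₀ hx.1 hx2.1] at this
      have hx0 := hx.1
      nlinarith
    have h5 : Ω x ^ 2 ≤ 4 * Ω (x / 2) ^ 2 := by nlinarith [hpos x hx]
    simp only [intervalIntegral.integral_const, smul_eq_mul] at h1
    have h6 : J x = J (x / 2) + ∫ t in (x / 2)..x, Ω t ^ 2 := h2.symm
    nlinarith [hx.1]
  set h : ℝ → ℝ := fun x => J x / x ^ 2 with hh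
  have hhcont : ContinuousOn h (Ioc 0 1) :=
    (hJcont.mono Ioc_subset_Icc_self).div (by fun_prop) fun x hx => by
      have := hx.1; positivity
  have hh0 : ∀ x ∈ Ioc (0 : ℝ) 1, 0 ≤ h x := fun x hx => div_nonneg (hJ0 x hx) (sq_nonneg _)
  have hhint : ∀ x ∈ Ioc (0 : ℝ) 1, IntervalIntegrable h volume x 1 := fun x hx =>
    (hhcont.mono fun t ht => by
      rw [uIcc_of_le hx.2] at ht; exact ⟨hx.1.trans_le ht.1, ht.2⟩).intervalIntegrable
  have hcat : ∀ x ∈ Ioo (0 : ℝ) 1, ContinuousAt Ω x := fun x hx =>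
    hcont.continuousAt (Ioc_mem_nhds hx.1 hx.2)
  refine ⟨fun x => 1 + ∫ t in x..1, h t, h,
    fun x => (Ω x ^ 2 * x ^ 2 - J x * (2 * x)) / (x ^ 2) ^ 2, ?_, fun x hx => ?_⟩
  · refine ContinuousOn.div ?_ (by fun_prop) fun x hx => by have := hx.1; positivity
    have h1 := hcont.mono Ioo_subset_Ioc_self
    have h2 := hJcont.mono Ioo_subset_Icc_self
    exact ((h1.pow 2).mul (by fun_prop)).sub (h2.mul (by fun_prop))
  · have hx' : x ∈ Ioc (0 : ℝ) 1 := ⟨hx.1, hx.2.le⟩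
    have hx0 := hx.1
    have hJd : HasDerivAt J (Ω x ^ 2) x := by
      refine intervalIntegral.integral_hasDerivAt_right (hsub 0 x le_rfl hx.1.le hx.2.le) ?_
        ((hcat x hx).pow 2)
      exact ContinuousOn.stronglyMeasurableAtFilter isOpen_Ioo
        ((hcont.mono Ioo_subset_Ioc_self).pow 2) x hx
    refine ⟨?_, ?_, ?_, hh0 x hx', ?_, ?_, ?_⟩
    · refine HasDerivAt.const_add 1 ?_
      refine intervalIntegral.integral_hasDerivAt_left (hhint x hx') ?_ ?_
      · exact ContinuousOn.stronglyMeasurableAtFilter isOpen_Ioo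
          (hhcont.mono Ioo_subset_Ioc_self) x hx
      · exact hhcont.continuousAt (Ioc_mem_nhds hx.1 hx.2)
    · have := hJd.fun_div (hasDerivAt_pow 2 x) (by positivity)
      simpa using this
    · have : 0 ≤ ∫ t in x..1, h t := intervalIntegral.integral_nonneg hx.2.le fun t ht =>
        hh0 t ⟨hx.1.trans_le ht.1, ht.2⟩
      linarith
    · rw [hh]
      simp only
      rw [div_le_div_iff₀ (by positivity) hx0]
      nlinarith [hJle x hx', hJ0 x hx']
    · have h1 := hJle x hx'
      have h2 := hJ0 x hx'
      rw [abs_le]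
      have e : (x ^ 2) ^ 2 = x ^ 2 * x ^ 2 := by ring
      constructor
      · rw [← neg_div, div_le_div_iff₀ (by positivity) (by positivity), e, ← mul_assoc]
        refine mul_le_mul_of_nonneg_right ?_ (sq_nonneg x)
        nlinarith
      · rw [div_le_div_iff₀ (by positivity) (by positivity), e, ← mul_assoc (Ω x ^ 2)]
        refine mul_le_mul_of_nonneg_right ?_ (sq_nonneg x)
        nlinarith
    · have hIoo : ∫⁻ t in Ioo x 1, ENNReal.ofReal (Ω t ^ 2 / t)
          ≤ ENNReal.ofReal (8 * ∫ t in x..1, h t) := by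
        rw [← intervalIntegral.integral_const_mul, intervalIntegral.integral_of_le hx.2.le,
          ofReal_integral_eq_lintegral_ofReal]
        · refine (lintegral_mono_set Ioo_subset_Ioc_self).trans ?_
          refine setLIntegral_mono' measurableSet_Ioc fun t ht => ?_
          refine ENNReal.ofReal_le_ofReal ?_
          have ht' : t ∈ Ioc (0 : ℝ) 1 := ⟨hx.1.trans ht.1, ht.2⟩
          have ht0 := ht'.1
          rw [hh]
          simp only
          rw [mul_div_assoc', div_le_div_iff₀ ht0 (by positivity)]
          nlinarith [hJge t ht']
        · exact ((hhint x hx').const_mul 8).1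
        · filter_upwards [ae_restrict_mem measurableSet_Ioc] with t ht
          exact mul_nonneg (by norm_num) (hh0 t ⟨hx.1.trans ht.1, ht.2⟩)
      have hnn : 0 ≤ ∫ t in x..1, h t := intervalIntegral.integral_nonneg hx.2.le fun t ht =>
        hh0 t ⟨hx.1.trans_le ht.1, ht.2⟩
      unfold quadPhi quadIntegral
      calc _ ≤ ENNReal.ofReal 1 + ENNReal.ofReal (8 * ∫ t in x..1, h t) := by
            rw [ENNReal.ofReal_one]; gcongr
        _ = ENNReal.ofReal (1 + 8 * ∫ t in x..1, h t) :=
            (ENNReal.ofReal_add zero_le_one (by positivity)).symm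
        _ ≤ _ := ENNReal.ofReal_le_ofReal (by linarith)

end Weight

/-! ### Circular means in logarithmic coordinates. -/

section CircularMeans

open ComplexConjugate

/-- In use, `W₁` and `W₂` are the first and second θ-derivatives of `V`. By periodicity `W₂`
integrates to zero, so adding it turns the second s-derivative into the full Laplacian for free. -/
lemma integral_taylor_of_periodic {V V₁ V₂ W₁ W₂ : ℝ → ℝ → ℝ} {T : ℝ} (hT : 0 ≤ T)
    (hV : ∀ s < 0, ∀ θ, HasDerivAt (fun t => V t θ) (V₁ s θ) s)
    (hV₁ : ∀ s < 0, ∀ θ, HasDerivAt (fun t => V₁ t θ) (V₂ s θ) s)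
    (hW₁ : ∀ s < 0, ∀ θ, HasDerivAt (W₁ s) (W₂ s θ) θ)
    (hper : ∀ s < 0, W₁ s T = W₁ s 0)
    (cV : ContinuousOn (Function.uncurry V) (Iio 0 ×ˢ univ))
    (cV₁ : ContinuousOn (Function.uncurry V₁) (Iio 0 ×ˢ univ))
    (cV₂ : ContinuousOn (Function.uncurry V₂) (Iio 0 ×ˢ univ))
    (cW₂ : ContinuousOn (Function.uncurry W₂) (Iio 0 ×ˢ univ))
    {a s : ℝ} (has : a ≤ s) (hs : s < 0) :
    ∫ θ in (0 : ℝ)..T, V s θ = (∫ θ in (0 : ℝ)..T, V a θ) + (s - a) * (∫ θ in (0 : ℝ)..T, V₁ a θ)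
      + ∫ τ in a..s, (s - τ) * ∫ θ in (0 : ℝ)..T, (V₂ τ θ + W₂ τ θ) := by
  have ha : a < 0 := has.trans_lt hs
  have slice : ∀ {U : ℝ → ℝ → ℝ}, ContinuousOn (Function.uncurry U) (Iio 0 ×ˢ univ) →
      ∀ τ < 0, Continuous (U τ) := by
    intro U hU τ hτ
    have : ContinuousOn (fun θ => Function.uncurry U (τ, θ)) univ :=
      hU.comp (by fun_prop) fun θ _ => ⟨hτ, trivial⟩
    simpa [Function.uncurry, continuousOn_univ] using this
  have slice' : ∀ {U : ℝ → ℝ → ℝ}, ContinuousOn (Function.uncurry U) (Iio 0 ×ˢ univ) →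
      ∀ θ, ContinuousOn (fun τ => U τ θ) (Icc a s) := by
    intro U hU θ
    exact hU.comp (f := fun τ => (τ, θ)) (by fun_prop) fun τ hτ => ⟨hτ.2.trans_lt hs, trivial⟩
  have hneg : ∀ τ ∈ uIcc a s, τ < 0 := fun τ hτ => by
    rw [uIcc_of_le has] at hτ; exact hτ.2.trans_lt hs
  have taylor : ∀ θ, V s θ = V a θ + (s - a) * V₁ a θ + ∫ τ in a..s, (s - τ) * V₂ τ θ := by
    intro θ
    have h := intervalIntegral.integral_eq_sub_of_hasDerivAt
      (f := fun τ => V τ θ + (s - τ) * V₁ τ θ) (f' := fun τ => (s - τ) * V₂ τ θ) (a := a) (b := s)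
      (fun τ hτ => by
        have h1 := (hV τ (hneg τ hτ) θ).add
          ((((hasDerivAt_id τ).const_sub s)).mul (hV₁ τ (hneg τ hτ) θ))
        exact h1.congr_deriv (by simp))
      (ContinuousOn.intervalIntegrable (by
        rw [uIcc_of_le has]
        exact (by fun_prop : ContinuousOn (fun τ : ℝ => s - τ) (Icc a s)).mul (slice' cV₂ θ)))
    rw [h]
    ring
  have hW0 : ∀ τ < 0, ∫ θ in (0 : ℝ)..T, W₂ τ θ = 0 := by
    intro τ hτ
    rw [intervalIntegral.integral_eq_sub_of_hasDerivAt (fun θ _ => hW₁ τ hτ θ)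
      ((slice cW₂ τ hτ).intervalIntegrable _ _), hper τ hτ, sub_self]
  have cprod : ContinuousOn (fun q : ℝ × ℝ => (s - q.1) * V₂ q.1 q.2) (Icc a s ×ˢ Icc 0 T) := by
    refine ContinuousOn.mul (by fun_prop) ?_
    exact cV₂.mono fun q hq => ⟨hq.1.2.trans_lt hs, trivial⟩
  have hi : IntegrableOn (Function.uncurry fun τ θ => (s - τ) * V₂ τ θ) (uIoc a s ×ˢ uIoc 0 T) := by
    have := cprod.integrableOn_compact (μ := volume) (isCompact_Icc.prod isCompact_Icc)
    rw [uIoc_of_le has, uIoc_of_le hT]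
    exact this.mono_set (prod_mono Ioc_subset_Icc_self Ioc_subset_Icc_self)
  have swap := intervalIntegral_intervalIntegral_swap hi
  have e1 : ∫ τ in a..s, (s - τ) * ∫ θ in (0 : ℝ)..T, (V₂ τ θ + W₂ τ θ)
      = ∫ θ in (0 : ℝ)..T, ∫ τ in a..s, (s - τ) * V₂ τ θ := by
    rw [← swap]
    refine intervalIntegral.integral_congr fun τ hτ => ?_
    rw [intervalIntegral.integral_add ((slice cV₂ τ (hneg τ hτ)).intervalIntegrable _ _)
      ((slice cW₂ τ (hneg τ hτ)).intervalIntegrable _ _), hW0 τ (hneg τ hτ), add_zero,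
      intervalIntegral.integral_const_mul]
  have i3 : IntervalIntegrable (fun θ => ∫ τ in a..s, (s - τ) * V₂ τ θ) volume 0 T := by
    have : (fun θ => ∫ τ in a..s, (s - τ) * V₂ τ θ)
        = fun θ => V s θ - (V a θ + (s - a) * V₁ a θ) := by
      ext θ; rw [taylor θ]; ring
    rw [this]
    have h1 := slice cV s hs
    have h2 := slice cV a ha
    have h3 := slice cV₁ a ha
    exact (by fun_prop : Continuous fun θ => V s θ - (V a θ + (s - a) * V₁ a θ)).intervalIntegrable _ _
  rw [e1, intervalIntegral.integral_congr (g := fun θ => (V a θ + (s - a) * V₁ a θ) +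
    ∫ τ in a..s, (s - τ) * V₂ τ θ) (fun θ _ => taylor θ),
    intervalIntegral.integral_add _ i3, intervalIntegral.integral_add,
    intervalIntegral.integral_const_mul]
  · exact (slice cV a ha).intervalIntegrable _ _
  · exact ((slice cV₁ a ha).intervalIntegrable _ _).const_mul _
  · exact ((slice cV a ha).intervalIntegrable _ _).add
      (((slice cV₁ a ha).intervalIntegrable _ _).const_mul _)

/-- Half of `1 - |w|²`, a smooth substitute for the distance to the circle. -/
noncomputable def halfDefect (w : ℂ) : ℝ := (1 - ‖w‖ ^ 2) / 2

lemma halfDefect_mem {w : ℂ} (hw : w ∈ Metric.ball (0 : ℂ) 1) : halfDefect w ∈ Ioo (0 : ℝ) 1 := by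
  have h : ‖w‖ < 1 := by simpa using hw
  have h0 := norm_nonneg w
  unfold halfDefect
  constructor <;> nlinarith

lemma halfDefect_le {w : ℂ} (hw : w ∈ Metric.ball (0 : ℂ) 1) : halfDefect w ≤ 1 - ‖w‖ := by
  have h : ‖w‖ < 1 := by simpa using hw
  unfold halfDefect
  nlinarith [norm_nonneg w]

lemma le_two_mul_halfDefect {w : ℂ} (hw : w ∈ Metric.ball (0 : ℂ) 1) :
    1 - ‖w‖ ≤ 2 * halfDefect w := by
  have h : ‖w‖ < 1 := by simpa using hw
  unfold halfDefect
  nlinarith [norm_nonneg w]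

lemma continuous_halfDefect : Continuous halfDefect := by
  unfold halfDefect; fun_prop

lemma hasDerivAt_halfDefect {γ : ℝ → ℂ} {γ' : ℂ} {t : ℝ} (h : HasDerivAt γ γ' t) :
    HasDerivAt (fun t => halfDefect (γ t)) (-(conj (γ t) * γ').re) t := by
  have h1 := ((h.norm_sq.const_sub 1).div_const 2)
  unfold halfDefect
  refine h1.congr_deriv ?_
  rw [Complex.inner, Complex.mul_re, Complex.mul_re]
  simp
  ring

lemma hasDerivAt_re_conj_mul {γ δ : ℝ → ℂ} {γ' δ' : ℂ} {t : ℝ} (h : HasDerivAt γ γ' t)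
    (hδ : HasDerivAt δ δ' t) :
    HasDerivAt (fun t => (conj (γ t) * δ t).re) ((conj γ' * δ t).re + (conj (γ t) * δ').re) t := by
  have h1 : HasDerivAt (fun t => conj (γ t)) (conj γ') t := h.star
  have h2 := Complex.reCLM.hasFDerivAt.comp_hasDerivAt t (h1.mul hδ)
  simpa [Function.comp_def] using h2

variable {K K₁ K₂ : ℝ → ℝ} {f : ℂ → ℂ}

/-- Circular means of `K (halfDefect f)` in logarithmic coordinates: Taylor's formula with the
Laplacian as second derivative. -/
lemma exists_taylor_circularMean (hK : ∀ x ∈ Ioo (0 : ℝ) 1, HasDerivAt K (K₁ x) x)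
    (hK₁ : ∀ x ∈ Ioo (0 : ℝ) 1, HasDerivAt K₁ (K₂ x) x) (hK₂ : ContinuousOn K₂ (Ioo 0 1))
    (hf : DifferentiableOn ℂ f {z | z.re < 0})
    (hmaps : MapsTo f {z | z.re < 0} (Metric.ball 0 1))
    (hper : ∀ z, f (z + (2 * Real.pi : ℝ) * Complex.I) = f z) (a : ℝ) :
    ∃ A : ℝ, ∀ s, a ≤ s → s < 0 →
      ∫ θ in (0 : ℝ)..(2 * Real.pi), K (halfDefect (f (s + θ * Complex.I))) =
        (∫ θ in (0 : ℝ)..(2 * Real.pi), K (halfDefect (f (a + θ * Complex.I)))) + (s - a) * A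
        + ∫ τ in a..s, (s - τ) * ∫ θ in (0 : ℝ)..(2 * Real.pi),
          (K₂ (halfDefect (f (τ + θ * Complex.I))) * ‖f (τ + θ * Complex.I)‖ ^ 2
            - 2 * K₁ (halfDefect (f (τ + θ * Complex.I)))) * ‖deriv f (τ + θ * Complex.I)‖ ^ 2 := by
  set H : Set ℂ := {z | z.re < 0} with hH
  have hHo : IsOpen H := isOpen_lt Complex.continuous_re continuous_const
  set f₁ := deriv f with hf₁
  set f₂ := deriv f₁ with hf₂
  have df₁ : DifferentiableOn ℂ f₁ H := hf.deriv hHo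
  have df₂ : DifferentiableOn ℂ f₂ H := df₁.deriv hHo
  have hper₁ : ∀ z, f₁ (z + (2 * Real.pi : ℝ) * Complex.I) = f₁ z := by
    intro z
    rw [hf₁, ← deriv_comp_add_const]
    congr 1
    ext w; exact hper w
  have hX : ∀ z ∈ H, halfDefect (f z) ∈ Ioo (0 : ℝ) 1 := fun z hz => halfDefect_mem (hmaps hz)
  have cK : ContinuousOn K (Ioo 0 1) := fun x hx => (hK x hx).continuousAt.continuousWithinAt
  have cK₁ : ContinuousOn K₁ (Ioo 0 1) := fun x hx => (hK₁ x hx).continuousAt.continuousWithinAt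
  have cX : ContinuousOn (fun z => halfDefect (f z)) H :=
    continuous_halfDefect.comp_continuousOn hf.continuousOn
  -- first and second derivative in the direction `e`
  set D : ℂ → ℂ → ℝ := fun e z => K₁ (halfDefect (f z)) * -(conj (f z) * (f₁ z * e)).re with hD
  set D₂ : ℂ → ℂ → ℝ := fun e z => K₂ (halfDefect (f z)) * (conj (f z) * (f₁ z * e)).re ^ 2
    - K₁ (halfDefect (f z)) * ((conj (f₁ z * e) * (f₁ z * e)).re
      + (conj (f z) * (f₂ z * e * e)).re) with hD₂
  have cD : ∀ e, ContinuousOn (D e) H := by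
    intro e
    refine (cK₁.comp cX hX).mul (ContinuousOn.neg ?_)
    refine Complex.continuous_re.comp_continuousOn ?_
    exact (Complex.continuous_conj.comp_continuousOn hf.continuousOn).mul
      (df₁.continuousOn.mul continuousOn_const)
  have cD₂ : ∀ e, ContinuousOn (D₂ e) H := by
    intro e
    have c1 : ContinuousOn (fun z => f₁ z * e) H := df₁.continuousOn.mul continuousOn_const
    have c2 : ContinuousOn (fun z => f₂ z * e * e) H :=
      (df₂.continuousOn.mul continuousOn_const).mul continuousOn_const
    have c3 := Complex.continuous_conj.comp_continuousOn hf.continuousOn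
    have c4 := Complex.continuous_conj.comp_continuousOn c1
    refine ((hK₂.comp cX hX).mul ((Complex.continuous_re.comp_continuousOn (c3.mul c1)).pow 2)).sub
      ((cK₁.comp cX hX).mul ?_)
    exact (Complex.continuous_re.comp_continuousOn (c4.mul c1)).add
      (Complex.continuous_re.comp_continuousOn (c3.mul c2))
  have step : ∀ (g g' : ℂ → ℂ), (∀ z ∈ H, HasDerivAt g (g' z) z) → ∀ (ℓ : ℝ → ℂ) (e : ℂ) (t : ℝ),
      HasDerivAt ℓ e t → ℓ t ∈ H → HasDerivAt (fun t => g (ℓ t)) (g' (ℓ t) * e) t :=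
    fun g g' hg ℓ e t hℓ hm => (hg _ hm).comp_of_eq t hℓ rfl
  have hff : ∀ z ∈ H, HasDerivAt f (f₁ z) z := fun z hz =>
    (hf.differentiableAt (hHo.mem_nhds hz)).hasDerivAt
  have hff₁ : ∀ z ∈ H, HasDerivAt f₁ (f₂ z) z := fun z hz =>
    (df₁.differentiableAt (hHo.mem_nhds hz)).hasDerivAt
  have hd1 : ∀ (ℓ : ℝ → ℂ) (e : ℂ) (t : ℝ), HasDerivAt ℓ e t → ℓ t ∈ H →
      HasDerivAt (fun t => K (halfDefect (f (ℓ t)))) (D e (ℓ t)) t := by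
    intro ℓ e t hℓ hm
    exact (hK _ (hX _ hm)).comp t (hasDerivAt_halfDefect (step f f₁ hff ℓ e t hℓ hm))
  have hd2 : ∀ (ℓ : ℝ → ℂ) (e : ℂ) (t : ℝ), HasDerivAt ℓ e t → ℓ t ∈ H →
      HasDerivAt (fun t => D e (ℓ t)) (D₂ e (ℓ t)) t := by
    intro ℓ e t hℓ hm
    have h0 := step f f₁ hff ℓ e t hℓ hm
    have h1 := (hK₁ _ (hX _ hm)).comp t (hasDerivAt_halfDefect h0)
    have h2 := hasDerivAt_re_conj_mul h0 ((step f₁ f₂ hff₁ ℓ e t hℓ hm).mul_const e)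
    refine (h1.mul h2.neg).congr_deriv ?_
    simp only [hD₂, Function.comp_apply, Pi.neg_apply]
    ring
  have hmem : ∀ s < (0 : ℝ), ∀ θ : ℝ, (s + θ * Complex.I : ℂ) ∈ H := fun s hs θ => by
    simpa [hH] using hs
  have hls : ∀ s θ : ℝ, HasDerivAt (fun t : ℝ => (t + θ * Complex.I : ℂ)) 1 s := fun s θ =>
    (Complex.ofRealCLM.hasDerivAt (x := s)).add_const _
  have hlθ : ∀ s θ : ℝ, HasDerivAt (fun t : ℝ => (s + t * Complex.I : ℂ)) Complex.I θ := fun s θ => by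
    simpa using ((Complex.ofRealCLM.hasDerivAt (x := θ)).mul_const Complex.I).const_add (s : ℂ)
  have cpair : ∀ {U : ℂ → ℝ}, ContinuousOn U H →
      ContinuousOn (Function.uncurry fun s θ : ℝ => U (s + θ * Complex.I)) (Iio 0 ×ˢ univ) := by
    intro U hU
    refine hU.comp (f := fun q : ℝ × ℝ => (q.1 + q.2 * Complex.I : ℂ)) (by fun_prop) ?_
    intro q hq
    exact hmem q.1 hq.1 q.2
  refine ⟨∫ θ in (0 : ℝ)..(2 * Real.pi), D 1 (a + θ * Complex.I), fun s has hs => ?_⟩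
  have hp0 : ∀ s < (0 : ℝ), D Complex.I (s + (2 * Real.pi : ℝ) * Complex.I)
      = D Complex.I (s + (0 : ℝ) * Complex.I) := by
    intro s _
    simp only [hD, hper, hper₁, Complex.ofReal_zero, zero_mul, add_zero]
  rw [integral_taylor_of_periodic (V := fun s θ => K (halfDefect (f (s + θ * Complex.I))))
    (V₁ := fun s θ => D 1 (s + θ * Complex.I)) (V₂ := fun s θ => D₂ 1 (s + θ * Complex.I))
    (W₁ := fun s θ => D Complex.I (s + θ * Complex.I))
    (W₂ := fun s θ => D₂ Complex.I (s + θ * Complex.I)) Real.two_pi_pos.le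
    (fun s hs θ => hd1 _ 1 s (hls s θ) (hmem s hs θ))
    (fun s hs θ => hd2 _ 1 s (hls s θ) (hmem s hs θ))
    (fun s hs θ => hd2 _ Complex.I θ (hlθ s θ) (hmem s hs θ)) hp0
    (cpair (cK.comp cX hX)) (cpair (cD 1)) (cpair (cD₂ 1)) (cpair (cD₂ Complex.I)) has hs]
  congr 1
  refine intervalIntegral.integral_congr fun τ _ => ?_
  congr 1
  refine intervalIntegral.integral_congr fun θ _ => ?_
  -- Summing over the directions 1 and i cancels the f'' terms, since 1 + i² = 0, and completes the
  -- squares to |f|²|f'|².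
  simp only [hD₂, Complex.sq_norm, Complex.normSq_apply]
  simp only [Complex.mul_re, Complex.mul_im, Complex.conj_re, Complex.conj_im, Complex.one_re,
    Complex.one_im, Complex.I_re, Complex.I_im]
  ring

end CircularMeans

/-! ### Inequalities for the Laplacian, the weight ω and the absorption step. -/

section Estimate

/-- No integrability is required, because the Bochner integral of a non-integrable function is 0. -/
lemma ofReal_integral_le_lintegral {α : Type*} [MeasurableSpace α] {μ : Measure α} (f : α → ℝ) :
    ENNReal.ofReal (∫ x, f x ∂μ) ≤ ∫⁻ x, ENNReal.ofReal (f x) ∂μ := by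
  by_cases hf : Integrable f μ
  · calc ENNReal.ofReal (∫ x, f x ∂μ) ≤ ENNReal.ofReal (∫ x, max (f x) 0 ∂μ) :=
        ENNReal.ofReal_le_ofReal (integral_mono hf hf.pos_part fun x => le_max_left _ _)
      _ = ∫⁻ x, ENNReal.ofReal (max (f x) 0) ∂μ :=
        ofReal_integral_eq_lintegral_ofReal hf.pos_part (ae_of_all _ fun x => le_max_right _ _)
      _ = _ := by
        refine lintegral_congr fun x => ?_
        rcases le_total (f x) 0 with h | h
        · rw [max_eq_right h, ENNReal.ofReal_of_nonpos h, ENNReal.ofReal_zero]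
        · rw [max_eq_left h]
  · rw [integral_undef hf]; simp

lemma exists_rpow_majorant {Ω : ℝ → ℝ} {p : ℝ} (hp : 1 ≤ p) (hpos : IsGauge Ω)
    (hmono : MonotoneOn Ω (Ioc 0 1)) (hanti : AntitoneOn (fun t : ℝ => Ω t / t) (Ioc 0 1)) :
    ∃ F K₁ K₂ : ℝ → ℝ, ∃ C : ℝ, 0 ≤ C ∧ ContinuousOn F (Ioo 0 1) ∧ ContinuousOn K₂ (Ioo 0 1) ∧
      (∀ x ∈ Ioo (0 : ℝ) 1, HasDerivAt (fun x => F x ^ p) (K₁ x) x) ∧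
      (∀ x ∈ Ioo (0 : ℝ) 1, HasDerivAt K₁ (K₂ x) x) ∧ (∀ x ∈ Ioo (0 : ℝ) 1, 1 ≤ F x) ∧
      (∀ x ∈ Ioo (0 : ℝ) 1, quadPhi Ω x ≤ ENNReal.ofReal (8 * F x)) ∧
      ∀ x ∈ Ioo (0 : ℝ) 1, ∀ m ∈ Icc (0 : ℝ) 1,
        K₂ x * m - 2 * K₁ x ≤ C * F x ^ (p - 1) * (Ω x / x) ^ 2 := by
  obtain ⟨F, h, h', ch', H⟩ := exists_smooth_majorant hpos hmono hanti
  have hF1 : ∀ x ∈ Ioo (0 : ℝ) 1, 1 ≤ F x := fun x hx => (H x hx).2.2.1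
  have cF : ContinuousOn F (Ioo 0 1) := fun x hx => (H x hx).1.continuousAt.continuousWithinAt
  have ch : ContinuousOn h (Ioo 0 1) := fun x hx => (H x hx).2.1.continuousAt.continuousWithinAt
  have cFp : ∀ q : ℝ, ContinuousOn (fun x => F x ^ q) (Ioo 0 1) := fun q =>
    cF.rpow_const fun x hx => Or.inl (by linarith [hF1 x hx])
  refine ⟨F, fun x => p * F x ^ (p - 1) * -h x,
    fun x => p * (p - 1) * F x ^ (p - 2) * h x ^ 2 - p * F x ^ (p - 1) * h' x,
    -- The first term absorbs h² ≤ Ω(1)²(Ω/x)², with F^(p-2) ≤ F^(p-1) because F ≥ 1; in 3p, one p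
    -- comes from h' and two from -2K₁. The variable `m` plays the role of |φ|².
    p * (p - 1) * Ω 1 ^ 2 + 3 * p, by have := hp; have : 0 ≤ p - 1 := by linarith
                                      positivity, cF, ?_, fun x hx => ?_, fun x hx => ?_, hF1,
    fun x hx => (H x hx).2.2.2.2.2.2, fun x hx m hm => ?_⟩
  · exact ((continuousOn_const.mul (cFp _)).mul (ch.pow 2)).sub
      ((continuousOn_const.mul (cFp _)).mul ch')
  · refine ((H x hx).1.rpow_const (p := p) (Or.inl (by linarith [hF1 x hx]))).congr_deriv ?_
    ring
  · have h1 := (H x hx).1.rpow_const (p := p - 1) (Or.inl (by linarith [hF1 x hx]))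
    refine ((h1.const_mul p).mul (H x hx).2.1.neg).congr_deriv ?_
    rw [show p - 1 - 1 = p - 2 by ring]
    simp only [Pi.neg_apply]
    ring
  · obtain ⟨-, -, h1, h2, h3, h4, -⟩ := H x hx
    have hx0 := hx.1
    have hΩ0 := hpos x ⟨hx.1, hx.2.le⟩
    have hΩ1 : Ω x ≤ Ω 1 := hmono ⟨hx.1, hx.2.le⟩ ⟨one_pos, le_rfl⟩ hx.2.le
    set q := (Ω x / x) ^ 2 with hq
    have hq0 : 0 ≤ q := sq_nonneg _
    have hq' : q = Ω x ^ 2 / x ^ 2 := div_pow _ _ _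
    set A := F x ^ (p - 1) with hA
    have hA0 : 0 ≤ A := by positivity
    have hB : F x ^ (p - 2) ≤ A := Real.rpow_le_rpow_of_exponent_le h1 (by linarith)
    have hB0 : 0 ≤ F x ^ (p - 2) := by positivity
    have hh2 : h x ^ 2 ≤ Ω 1 ^ 2 * q := by
      calc h x ^ 2 ≤ (Ω x ^ 2 / x) ^ 2 := pow_le_pow_left₀ h2 h3 2
        _ = Ω x ^ 2 * q := by rw [hq']; field_simp
        _ ≤ _ := by gcongr
    have hhq : h x ≤ q := by
      refine h3.trans ?_
      rw [hq']
      gcongr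
      nlinarith [hx.2]
    rw [← hq'] at h4
    have hp0 : 0 ≤ p - 1 := by linarith
    have t1 : F x ^ (p - 2) * h x ^ 2 ≤ A * (Ω 1 ^ 2 * q) := by gcongr
    have t1' : F x ^ (p - 2) * h x ^ 2 * m ≤ A * (Ω 1 ^ 2 * q) :=
      (mul_le_of_le_one_right (by positivity) hm.2).trans t1
    have t2 : -h' x * m ≤ q := by
      have : -h' x ≤ q := (neg_le_abs _).trans h4
      nlinarith [hm.1, hm.2]
    calc (p * (p - 1) * F x ^ (p - 2) * h x ^ 2 - p * A * h' x) * m - 2 * (p * A * -h x)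
        = p * (p - 1) * (F x ^ (p - 2) * h x ^ 2 * m) + p * A * (-h' x * m) + 2 * p * A * h x := by
          ring
      _ ≤ p * (p - 1) * (A * (Ω 1 ^ 2 * q)) + p * A * q + 2 * p * A * q := by gcongr
      _ = _ := by ring

/-- Substitute t = 1 - exp τ. Since -τ ≤ exp(-τ) - 1 = exp(-2τ) · exp τ · (1 - exp τ), the weight -τ
supplies the Jacobian exp τ and cancels one factor of t, at the cost of exp(-2a). -/
lemma lintegral_log_weight_le (ω : ℝ → ℝ) (a : ℝ) :
    ∫⁻ τ in Ioo a 0, ENNReal.ofReal (-τ * (ω (1 - Real.exp τ) / (1 - Real.exp τ)) ^ 2)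
      ≤ ENNReal.ofReal (Real.exp (-2 * a)) * quadIntegral ω 0 := by
  have hd : ∀ τ ∈ Ioo a 0, HasDerivWithinAt (fun τ => 1 - Real.exp τ) (-Real.exp τ) (Ioo a 0) τ :=
    fun τ _ => ((Real.hasDerivAt_exp τ).const_sub 1).hasDerivWithinAt
  have hinj : InjOn (fun τ => 1 - Real.exp τ) (Ioo a 0) := fun x _ y _ h =>
    Real.exp_injective (by simpa using h)
  have h := lintegral_image_eq_lintegral_abs_deriv_mul measurableSet_Ioo hd hinj
    (fun t => ENNReal.ofReal (ω t ^ 2 / t))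
  have hsub : (fun τ => 1 - Real.exp τ) '' Ioo a 0 ⊆ Ioo 0 1 := by
    rintro _ ⟨τ, hτ, rfl⟩
    have := Real.exp_lt_one_iff.2 hτ.2
    have := Real.exp_pos τ
    constructor <;> simp only <;> linarith
  have h2 : ∫⁻ t in (fun τ => 1 - Real.exp τ) '' Ioo a 0, ENNReal.ofReal (ω t ^ 2 / t)
      ≤ quadIntegral ω 0 := lintegral_mono_set hsub
  refine le_trans ?_ (mul_le_mul_right h2 _)
  rw [h, ← lintegral_const_mul' _ _ ENNReal.ofReal_ne_top]
  refine setLIntegral_mono' measurableSet_Ioo fun τ hτ => ?_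
  have h1 := Real.exp_lt_one_iff.2 hτ.2
  have h0 := Real.exp_pos τ
  have hy : 0 < 1 - Real.exp τ := by linarith
  rw [abs_neg, abs_of_pos h0, ← ENNReal.ofReal_mul h0.le, ← ENNReal.ofReal_mul (Real.exp_pos _).le]
  refine ENNReal.ofReal_le_ofReal ?_
  have k1 : -τ ≤ Real.exp (-τ) - 1 := by linarith [Real.add_one_le_exp (-τ)]
  have k2 : Real.exp (-τ) - 1 = Real.exp (-2 * τ) * Real.exp τ * (1 - Real.exp τ) := by
    rw [← Real.exp_add, mul_sub, ← Real.exp_add, mul_one]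
    ring_nf
    simp [sub_eq_neg_add]
  have k3 : Real.exp (-2 * τ) ≤ Real.exp (-2 * a) := Real.exp_le_exp.2 (by linarith [hτ.1])
  have k4 : -τ ≤ Real.exp (-2 * a) * Real.exp τ * (1 - Real.exp τ) := by
    rw [k2] at k1
    refine k1.trans ?_
    gcongr
  calc -τ * (ω (1 - Real.exp τ) / (1 - Real.exp τ)) ^ 2
      ≤ Real.exp (-2 * a) * Real.exp τ * (1 - Real.exp τ)
        * (ω (1 - Real.exp τ) / (1 - Real.exp τ)) ^ 2 := by gcongr
    _ = _ := by field_simp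

/-- As N ≥ 1, also A ≤ A N^((p-1)/p); dividing by this finite nonzero power leaves N^(1/p) ≤ A + B.
-/
lemma le_rpow_of_le_add_mul_rpow {N A B : ℝ≥0∞} {p : ℝ} (hp : 1 ≤ p) (hN1 : 1 ≤ N) (hN : N ≠ ∞)
    (h : N ≤ A + B * N ^ ((p - 1) / p)) : N ≤ (A + B) ^ p := by
  have hp0 : 0 < p := by linarith
  have hq : 0 ≤ (p - 1) / p := div_nonneg (by linarith) hp0.le
  have h1 : 1 ≤ N ^ ((p - 1) / p) := (by simpa using ENNReal.rpow_le_rpow hN1 hq)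
  have hN0 : N ≠ 0 := fun h0 => by simp [h0] at hN1
  have h2 : N ^ (1 / p) * N ^ ((p - 1) / p) ≤ (A + B) * N ^ ((p - 1) / p) := by
    rw [← ENNReal.rpow_add _ _ hN0 hN, ← add_div, add_sub_cancel, div_self hp0.ne',
      ENNReal.rpow_one, add_mul]
    refine h.trans ?_
    gcongr
    exact le_mul_of_one_le_right' h1
  have h3 : N ^ (1 / p) ≤ A + B := by
    refine (ENNReal.mul_le_mul_iff_left ?_ ?_).1 h2
    · exact (zero_lt_one.trans_le h1).ne'
    · exact ENNReal.rpow_ne_top_of_nonneg hq hN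
  calc N = (N ^ (1 / p)) ^ p := by
        rw [← ENNReal.rpow_mul, one_div_mul_cancel hp0.ne', ENNReal.rpow_one]
    _ ≤ _ := ENNReal.rpow_le_rpow h3 hp0.le

end Estimate

/-! ### Uniform bound for the circular means. -/

section MainEstimate

variable {φ : ℂ → ℂ} {Ω : ℝ → ℝ}

lemma exp_add_mul_I_eq (s θ : ℝ) :
    Complex.exp (s + θ * Complex.I) = (Real.exp s : ℂ) * circleMap 0 1 θ := by
  simp [circleMap, Complex.exp_add]

lemma mul_circleMap_mem_ball {r : ℝ} (hr : r ∈ Ico (0 : ℝ) 1) (θ : ℝ) :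
    (r : ℂ) * circleMap 0 1 θ ∈ Metric.ball (0 : ℂ) 1 := by
  simp [abs_of_nonneg hr.1, hr.2]

lemma IsHolSelfMap.one_sub_norm_mem (hφ : IsHolSelfMap φ) {z : ℂ} (hz : z ∈ Metric.ball (0 : ℂ) 1) :
    1 - ‖φ z‖ ∈ Ioc (0 : ℝ) 1 := by
  have h : ‖φ z‖ < 1 := by simpa using hφ.2 hz
  exact ⟨by linarith, by linarith [norm_nonneg (φ z)]⟩

lemma continuousOn_hypDeriv (hφ : IsHolSelfMap φ) (hΩ : ContinuousOn Ω (Ioc 0 1)) :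
    ContinuousOn (hypDeriv Ω φ) (Metric.ball 0 1) := by
  have c1 : ContinuousOn (fun z => 1 - ‖φ z‖) (Metric.ball 0 1) :=
    continuousOn_const.sub hφ.1.continuousOn.norm
  refine ContinuousOn.mul (ContinuousOn.div ?_ c1 ?_) (hΩ.comp c1 ?_)
  · exact (hφ.1.deriv Metric.isOpen_ball).continuousOn.norm
  · exact fun z hz => (hφ.one_sub_norm_mem hz).1.ne'
  · exact fun z hz => hφ.one_sub_norm_mem hz

lemma hypDeriv_nonneg (hφ : IsHolSelfMap φ) (hΩ : IsGauge Ω) {z : ℂ}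
    (hz : z ∈ Metric.ball (0 : ℂ) 1) : 0 ≤ hypDeriv Ω φ z := by
  have h := hφ.one_sub_norm_mem hz
  exact mul_nonneg (div_nonneg (norm_nonneg _) h.1.le) (hΩ _ h).le

lemma norm_deriv_mul_halfDefect_le (hφ : IsHolSelfMap φ) (hΩ : IsGauge Ω)
    (hmono : MonotoneOn Ω (Ioc 0 1)) {z : ℂ} (hz : z ∈ Metric.ball (0 : ℂ) 1) :
    Ω (halfDefect (φ z)) / halfDefect (φ z) * ‖deriv φ z‖ ≤ 2 * hypDeriv Ω φ z := by
  have h := hφ.one_sub_norm_mem hz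
  have hX := halfDefect_mem (hφ.2 hz)
  have h1 := halfDefect_le (hφ.2 hz)
  have h2 := le_two_mul_halfDefect (hφ.2 hz)
  have hX' : halfDefect (φ z) ∈ Ioc (0 : ℝ) 1 := ⟨hX.1, hX.2.le⟩
  have h3 := hmono hX' h h1
  have h4 := hΩ _ h
  have hX0 := hX.1
  have hx0 := h.1
  have : Ω (halfDefect (φ z)) / halfDefect (φ z) ≤ 2 * (Ω (1 - ‖φ z‖) / (1 - ‖φ z‖)) := by
    rw [mul_div_assoc', div_le_div_iff₀ hX0 hx0]
    nlinarith
  calc _ ≤ 2 * (Ω (1 - ‖φ z‖) / (1 - ‖φ z‖)) * ‖deriv φ z‖ := by gcongr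
    _ = _ := by unfold hypDeriv; ring

lemma deriv_comp_exp (hφ : IsHolSelfMap φ) {z : ℂ} (hz : z.re < 0) :
    deriv (fun z => φ (Complex.exp z)) z = deriv φ (Complex.exp z) * Complex.exp z := by
  have hm : Complex.exp z ∈ Metric.ball (0 : ℂ) 1 := by
    simpa [Complex.norm_exp] using hz
  have h1 := (hφ.1.differentiableAt (Metric.isOpen_ball.mem_nhds hm)).hasDerivAt
  exact (h1.comp z (Complex.hasDerivAt_exp z)).deriv

lemma ofReal_integral_laplacian_le {F K₁ K₂ : ℝ → ℝ} {C p s : ℝ} (hφ : IsHolSelfMap φ)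
    (hp : 1 ≤ p) (hΩ : IsGauge Ω) (hmono : MonotoneOn Ω (Ioc 0 1))
    (hcont : ContinuousOn Ω (Ioc 0 1)) (hC : 0 ≤ C) (hF : ContinuousOn F (Ioo 0 1))
    (hF1 : ∀ x ∈ Ioo (0 : ℝ) 1, 1 ≤ F x)
    (hbd : ∀ x ∈ Ioo (0 : ℝ) 1, ∀ m ∈ Icc (0 : ℝ) 1,
        K₂ x * m - 2 * K₁ x ≤ C * F x ^ (p - 1) * (Ω x / x) ^ 2) (hs : s < 0) :
    ENNReal.ofReal (∫ θ in (0 : ℝ)..(2 * Real.pi),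
          (K₂ (halfDefect (φ (Complex.exp (s + θ * Complex.I)))) *
              ‖φ (Complex.exp (s + θ * Complex.I))‖ ^ 2
            - 2 * K₁ (halfDefect (φ (Complex.exp (s + θ * Complex.I))))) *
            ‖deriv (fun z => φ (Complex.exp z)) (s + θ * Complex.I)‖ ^ 2)
      ≤ ENNReal.ofReal (4 * C) *
        ((∫⁻ θ in Ioc 0 (2 * Real.pi),
          ENNReal.ofReal (F (halfDefect (φ (Real.exp s * circleMap 0 1 θ))) ^ p)) ^ ((p - 1) / p) *
        (∫⁻ θ in Ioc 0 (2 * Real.pi),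
          ENNReal.ofReal (hypDeriv Ω φ (Real.exp s * circleMap 0 1 θ)) ^ (2 * p)) ^ (1 / p)) := by
  have hp0 : 0 < p := by linarith
  have hr : Real.exp s ∈ Ico (0 : ℝ) 1 := ⟨(Real.exp_pos s).le, Real.exp_lt_one_iff.2 hs⟩
  have hball := mul_circleMap_mem_ball hr
  have hX : ∀ θ, halfDefect (φ (Real.exp s * circleMap 0 1 θ)) ∈ Ioo (0 : ℝ) 1 := fun θ =>
    halfDefect_mem (hφ.2 (hball θ))
  have ccirc : Continuous fun θ : ℝ => (Real.exp s : ℂ) * circleMap 0 1 θ := by fun_prop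
  have cφ : Continuous fun θ : ℝ => φ (Real.exp s * circleMap 0 1 θ) :=
    hφ.1.continuousOn.comp_continuous ccirc hball
  have cF : Continuous fun θ : ℝ => F (halfDefect (φ (Real.exp s * circleMap 0 1 θ))) :=
    hF.comp_continuous (continuous_halfDefect.comp cφ) hX
  have cD : Continuous fun θ : ℝ => hypDeriv Ω φ (Real.exp s * circleMap 0 1 θ) :=
    (continuousOn_hypDeriv hφ hcont).comp_continuous ccirc hball
  rw [intervalIntegral.integral_of_le Real.two_pi_pos.le]
  refine (ofReal_integral_le_lintegral _).trans ?_
  -- Hölder in its weighted form, with exponents (p-1)/p and 1/p summing to 1, covers p = 1 as well.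
  have hHolder := ENNReal.lintegral_mul_norm_pow_le (μ := volume.restrict (Ioc 0 (2 * Real.pi)))
    (f := fun θ => ENNReal.ofReal (F (halfDefect (φ (Real.exp s * circleMap 0 1 θ))) ^ p))
    (g := fun θ => ENNReal.ofReal (hypDeriv Ω φ (Real.exp s * circleMap 0 1 θ)) ^ (2 * p))
    (p := (p - 1) / p) (q := 1 / p)
    ((cF.measurable.pow_const p).ennreal_ofReal).aemeasurable
    ((cD.measurable.ennreal_ofReal).pow_const (2 * p)).aemeasurable (div_nonneg (by linarith) hp0.le) (by positivity)
    (by field_simp; ring)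
  refine le_trans ?_ (mul_le_mul_right hHolder _)
  rw [← lintegral_const_mul' _ _ ENNReal.ofReal_ne_top]
  refine lintegral_mono fun θ => ?_
  have hre : (s + θ * Complex.I : ℂ).re < 0 := by simpa using hs
  rw [deriv_comp_exp hφ hre, exp_add_mul_I_eq]
  have hb := hball θ
  have hx := hX θ
  set z : ℂ := Real.exp s * circleMap 0 1 θ with hz
  have hz1 : ‖z‖ ≤ 1 := by simpa using (Metric.ball_subset_closedBall hb)
  have hD0 := hypDeriv_nonneg hφ hΩ hb
  have hF0 : 0 ≤ F (halfDefect (φ z)) := by linarith [hF1 _ hx]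
  have hφz : ‖φ z‖ ≤ 1 := by
    have := Metric.ball_subset_closedBall (hφ.2 hb); simpa using this
  have e1 : ENNReal.ofReal (F (halfDefect (φ z)) ^ p) ^ ((p - 1) / p)
      = ENNReal.ofReal (F (halfDefect (φ z)) ^ (p - 1)) := by
    rw [ENNReal.ofReal_rpow_of_nonneg (by positivity) (div_nonneg (by linarith) hp0.le),
      ← Real.rpow_mul hF0, mul_div_cancel₀ _ hp0.ne']
  have e2 : (ENNReal.ofReal (hypDeriv Ω φ z) ^ (2 * p)) ^ (1 / p)
      = ENNReal.ofReal (hypDeriv Ω φ z ^ 2) := by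
    rw [← ENNReal.rpow_mul, mul_assoc, mul_one_div_cancel hp0.ne', mul_one,
      ENNReal.ofReal_rpow_of_nonneg hD0 (by norm_num), Real.rpow_two]
  rw [e1, e2, ← ENNReal.ofReal_mul (by positivity), ← ENNReal.ofReal_mul (by positivity)]
  refine ENNReal.ofReal_le_ofReal ?_
  have hA : 0 ≤ F (halfDefect (φ z)) ^ (p - 1) := by positivity
  have hX0 := hx.1
  have hΩX := hΩ _ ⟨hx.1, hx.2.le⟩
  have hle := norm_deriv_mul_halfDefect_le hφ hΩ hmono hb
  have hm : ‖φ z‖ ^ 2 ∈ Icc (0 : ℝ) 1 := ⟨sq_nonneg _, pow_le_one₀ (norm_nonneg _) hφz⟩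
  calc _ ≤ C * F (halfDefect (φ z)) ^ (p - 1) * (Ω (halfDefect (φ z)) / halfDefect (φ z)) ^ 2
        * ‖deriv φ z * z‖ ^ 2 := by
        gcongr
        exact hbd _ hx _ hm
    _ ≤ C * F (halfDefect (φ z)) ^ (p - 1) * (Ω (halfDefect (φ z)) / halfDefect (φ z)) ^ 2
        * ‖deriv φ z‖ ^ 2 := by
        gcongr
        rw [norm_mul]
        exact mul_le_of_le_one_right (norm_nonneg _) hz1
    _ = C * F (halfDefect (φ z)) ^ (p - 1)
        * (Ω (halfDefect (φ z)) / halfDefect (φ z) * ‖deriv φ z‖) ^ 2 := by ring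
    _ ≤ C * F (halfDefect (φ z)) ^ (p - 1) * (2 * hypDeriv Ω φ z) ^ 2 := by gcongr
    _ = _ := by ring

/-- Uniform bound for the circular means of the majorant of `Φ_Ω ^ p`. -/
lemma exists_circularMean_bound {F K₁ K₂ ω : ℝ → ℝ} {C p : ℝ} {c₀ : ℝ≥0∞} (hφ : IsHolSelfMap φ)
    (hp : 1 ≤ p) (hΩ : IsGauge Ω) (hmono : MonotoneOn Ω (Ioc 0 1))
    (hcont : ContinuousOn Ω (Ioc 0 1)) (hC : 0 ≤ C) (hF : ContinuousOn F (Ioo 0 1))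
    (hK₂ : ContinuousOn K₂ (Ioo 0 1))
    (hK : ∀ x ∈ Ioo (0 : ℝ) 1, HasDerivAt (fun x => F x ^ p) (K₁ x) x)
    (hK₁ : ∀ x ∈ Ioo (0 : ℝ) 1, HasDerivAt K₁ (K₂ x) x)
    (hF1 : ∀ x ∈ Ioo (0 : ℝ) 1, 1 ≤ F x)
    (hbd : ∀ x ∈ Ioo (0 : ℝ) 1, ∀ m ∈ Icc (0 : ℝ) 1,
        K₂ x * m - 2 * K₁ x ≤ C * F x ^ (p - 1) * (Ω x / x) ^ 2)
    (hω : quadIntegral ω 0 < ∞) (hc₀ : c₀ ≠ ∞)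
    (hD : ∀ r ∈ Ioo (0 : ℝ) 1, (∫⁻ θ in Ioc 0 (2 * Real.pi),
        ENNReal.ofReal (hypDeriv Ω φ (r * circleMap 0 1 θ)) ^ (2 * p)) ^ (1 / p)
        ≤ c₀ * ENNReal.ofReal ((ω (1 - r) / (1 - r)) ^ 2)) :
    ∃ B : ℝ≥0∞, B < ∞ ∧ ∀ r ∈ Ioo (0 : ℝ) 1, ∫⁻ θ in Ioc 0 (2 * Real.pi),
      ENNReal.ofReal (F (halfDefect (φ (r * circleMap 0 1 θ))) ^ p) ≤ B := by
  have hp0 : 0 < p := by linarith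
  set m : ℝ → ℝ≥0∞ := fun r => ∫⁻ θ in Ioc 0 (2 * Real.pi),
      ENNReal.ofReal (F (halfDefect (φ (r * circleMap 0 1 θ))) ^ p) with hm
  have hXb : ∀ z ∈ Metric.ball (0 : ℂ) 1, halfDefect (φ z) ∈ Ioo (0 : ℝ) 1 := fun z hz =>
    halfDefect_mem (hφ.2 hz)
  have cFp : ContinuousOn (fun z => F (halfDefect (φ z)) ^ p) (Metric.ball 0 1) := by
    refine ContinuousOn.rpow_const ?_ fun z hz => Or.inl (by linarith [hF1 _ (hXb z hz)])
    exact hF.comp (continuous_halfDefect.comp_continuousOn hφ.1.continuousOn) hXb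
  have hcompact : ∀ ρ < (1 : ℝ), ∃ B : ℝ≥0∞, B < ∞ ∧ ∀ r ∈ Icc (0 : ℝ) ρ, m r ≤ B := by
    intro ρ hρ
    obtain ⟨b, hb⟩ := (isCompact_closedBall (0 : ℂ) ρ).exists_bound_of_continuousOn
      (cFp.mono (Metric.closedBall_subset_ball hρ))
    refine ⟨∫⁻ _ in Ioc 0 (2 * Real.pi), ENNReal.ofReal b, ?_, fun r hr => ?_⟩
    · rw [setLIntegral_const]
      exact ENNReal.mul_lt_top ENNReal.ofReal_lt_top (by rw [Real.volume_Ioc]; exact ENNReal.ofReal_lt_top)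
    · refine lintegral_mono fun θ => ENNReal.ofReal_le_ofReal ?_
      refine (le_abs_self _).trans (hb _ ?_)
      simpa [abs_of_nonneg hr.1] using hr.2
  have hmge : ∀ r ∈ Ioo (0 : ℝ) 1, 1 ≤ m r := by
    intro r hr
    have h1 : ∫⁻ _ in Ioc 0 (2 * Real.pi), (1 : ℝ≥0∞) ≤ m r := by
      refine lintegral_mono fun θ => ?_
      have h := hF1 _ (hXb _ (mul_circleMap_mem_ball ⟨hr.1.le, hr.2⟩ θ))
      rw [← ENNReal.ofReal_one]
      exact ENNReal.ofReal_le_ofReal (Real.one_le_rpow h hp0.le)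
    refine le_trans ?_ h1
    rw [setLIntegral_const, one_mul, Real.volume_Ioc, ← ENNReal.ofReal_one]
    exact ENNReal.ofReal_le_ofReal (by linarith [Real.pi_gt_three])
  have hf : DifferentiableOn ℂ (fun z => φ (Complex.exp z)) {z | z.re < 0} := by
    refine hφ.1.comp Complex.differentiable_exp.differentiableOn fun z hz => ?_
    simpa [Complex.norm_exp] using hz
  have hmaps : MapsTo (fun z => φ (Complex.exp z)) {z | z.re < 0} (Metric.ball 0 1) := by
    intro z hz
    refine hφ.2 ?_
    simpa [Complex.norm_exp] using hz
  have hper : ∀ z, φ (Complex.exp (z + (2 * Real.pi : ℝ) * Complex.I)) = φ (Complex.exp z) := by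
    intro z
    congr 1
    push_cast
    exact Complex.exp_periodic z
  have hM : ∀ s < (0 : ℝ), m (Real.exp s) = ENNReal.ofReal
      (∫ θ in (0 : ℝ)..(2 * Real.pi), F (halfDefect (φ (Complex.exp (s + θ * Complex.I)))) ^ p) := by
    intro s hs
    have hr : Real.exp s ∈ Ico (0 : ℝ) 1 := ⟨(Real.exp_pos s).le, Real.exp_lt_one_iff.2 hs⟩
    have hball := mul_circleMap_mem_ball hr
    have c : Continuous fun θ : ℝ => F (halfDefect (φ (Real.exp s * circleMap 0 1 θ))) ^ p :=
      cFp.comp_continuous (by fun_prop) hball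
    simp_rw [exp_add_mul_I_eq]
    rw [intervalIntegral.integral_of_le Real.two_pi_pos.le, ofReal_integral_eq_lintegral_ofReal]
    · exact (c.intervalIntegrable 0 (2 * Real.pi)).1
    · refine ae_of_all _ fun θ => ?_
      exact Real.rpow_nonneg (by linarith [hF1 _ (hXb _ (hball θ))]) _
  obtain ⟨A, hA⟩ := exists_taylor_circularMean (K := fun x => F x ^ p) hK hK₁ hK₂ hf hmaps hper (-1)
  obtain ⟨B₁, hB₁, hB₁'⟩ := hcompact (Real.exp (-1)) (Real.exp_lt_one_iff.2 (by norm_num))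
  set A' : ℝ≥0∞ := m (Real.exp (-1)) + ENNReal.ofReal |A| with hA'
  set B' : ℝ≥0∞ := ENNReal.ofReal (4 * C) * c₀ * (ENNReal.ofReal (Real.exp (-2 * -1)) * quadIntegral ω 0)
    with hB'
  have hA'top : A' < ∞ := ENNReal.add_lt_top.2
    ⟨(hB₁' _ ⟨(Real.exp_pos _).le, le_rfl⟩).trans_lt hB₁, ENNReal.ofReal_lt_top⟩
  have hB'top : B' < ∞ := ENNReal.mul_lt_top (ENNReal.mul_lt_top ENNReal.ofReal_lt_top hc₀.lt_top)
    (ENNReal.mul_lt_top ENNReal.ofReal_lt_top hω)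
  have hmain : ∀ S, -1 ≤ S → S < 0 → m (Real.exp S) ≤ (A' + B') ^ p := by
    intro S hS1 hS0
    -- Stopping at S < 0 makes N finite by compactness, which the absorption needs; the resulting
    -- bound does not depend on S.
    set N : ℝ≥0∞ := ⨆ s ∈ Icc (-1) S, m (Real.exp s) with hN
    have hle : ∀ s ∈ Icc (-1) S, m (Real.exp s) ≤ N := fun s hs =>
      le_iSup₂ (f := fun s (_ : s ∈ Icc (-1) S) => m (Real.exp s)) s hs
    have hNtop : N ≠ ∞ := by
      obtain ⟨B₂, hB₂, hB₂'⟩ := hcompact (Real.exp S) (Real.exp_lt_one_iff.2 hS0)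
      refine ((iSup₂_le fun s hs => hB₂' _ ⟨(Real.exp_pos _).le, ?_⟩).trans_lt hB₂).ne
      exact Real.exp_le_exp.2 hs.2
    have hN1 : 1 ≤ N := (hmge _ ⟨Real.exp_pos _, Real.exp_lt_one_iff.2 hS0⟩).trans
      (hle S ⟨hS1, le_rfl⟩)
    refine (hle S ⟨hS1, le_rfl⟩).trans (le_rpow_of_le_add_mul_rpow hp hN1 hNtop ?_)
    refine iSup₂_le fun s hs => ?_
    have hs0 : s < 0 := hs.2.trans_lt hS0
    rw [hM s hs0, hA s hs.1 hs0]
    refine ENNReal.ofReal_add_le.trans (add_le_add (ENNReal.ofReal_add_le.trans ?_) ?_)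
    · rw [hA', hM (-1) (by norm_num)]
      gcongr
      calc (s - (-1)) * A ≤ (s - (-1)) * |A| := by
            exact mul_le_mul_of_nonneg_left (le_abs_self A) (by linarith [hs.1])
        _ ≤ 1 * |A| := by gcongr; linarith
        _ = |A| := one_mul _
    · rw [intervalIntegral.integral_of_le hs.1, integral_Ioc_eq_integral_Ioo]
      refine (ofReal_integral_le_lintegral _).trans ?_
      have hpt : ∀ τ ∈ Ioo (-1) s, ENNReal.ofReal ((s - τ) * ∫ θ in (0 : ℝ)..(2 * Real.pi),
          (K₂ (halfDefect (φ (Complex.exp (τ + θ * Complex.I)))) *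
              ‖φ (Complex.exp (τ + θ * Complex.I))‖ ^ 2
            - 2 * K₁ (halfDefect (φ (Complex.exp (τ + θ * Complex.I))))) *
            ‖deriv (fun z => φ (Complex.exp z)) (τ + θ * Complex.I)‖ ^ 2)
          ≤ ENNReal.ofReal (4 * C) * c₀ * N ^ ((p - 1) / p) * ENNReal.ofReal
            (-τ * (ω (1 - Real.exp τ) / (1 - Real.exp τ)) ^ 2) := by
        intro τ hτ
        have hτ0 : τ < 0 := hτ.2.trans hs0
        have hq : 0 ≤ (p - 1) / p := div_nonneg (by linarith) hp0.le
        rw [ENNReal.ofReal_mul (by linarith [hτ.2]), ENNReal.ofReal_mul (p := -τ) (by linarith)]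
        have h1 := ofReal_integral_laplacian_le hφ hp hΩ hmono hcont hC hF hF1 hbd hτ0
        have h2 := hD (Real.exp τ) ⟨Real.exp_pos _, Real.exp_lt_one_iff.2 hτ0⟩
        have h3 : m (Real.exp τ) ≤ N := hle τ ⟨hτ.1.le, hτ.2.le.trans hs.2⟩
        calc _ ≤ ENNReal.ofReal (-τ) * (ENNReal.ofReal (4 * C) * (N ^ ((p - 1) / p) *
              (c₀ * ENNReal.ofReal ((ω (1 - Real.exp τ) / (1 - Real.exp τ)) ^ 2)))) := by
              refine mul_le_mul' (ENNReal.ofReal_le_ofReal (by linarith)) (h1.trans ?_)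
              gcongr
          _ = _ := by ring
      refine (setLIntegral_mono' measurableSet_Ioo hpt).trans ?_
      rw [lintegral_const_mul' _ _ (ENNReal.mul_ne_top (ENNReal.mul_ne_top ENNReal.ofReal_ne_top hc₀)
        (ENNReal.rpow_ne_top_of_nonneg (div_nonneg (by linarith) hp0.le) hNtop))]
      calc _ ≤ ENNReal.ofReal (4 * C) * c₀ * N ^ ((p - 1) / p) *
            (ENNReal.ofReal (Real.exp (-2 * -1)) * quadIntegral ω 0) := by
            gcongr
            exact (lintegral_mono_set (Ioo_subset_Ioo_right hs0.le)).trans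
              (lintegral_log_weight_le ω (-1))
        _ = _ := by rw [hB']; ring
  refine ⟨max B₁ ((A' + B') ^ p), max_lt hB₁ ?_, fun r hr => ?_⟩
  · exact ENNReal.rpow_lt_top_of_nonneg hp0.le (ENNReal.add_lt_top.2 ⟨hA'top, hB'top⟩).ne
  · rcases le_total r (Real.exp (-1)) with h | h
    · exact (hB₁' r ⟨hr.1.le, h⟩).trans (le_max_left _ _)
    · refine le_trans ?_ (le_max_right _ _)
      have := hmain (Real.log r) ((Real.le_log_iff_exp_le hr.1).2 h) (Real.log_neg hr.1 hr.2)
      rwa [Real.exp_log hr.1] at this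

end MainEstimate

/-! ### Passage between the circle and the angle. -/

section CircleMeasure

lemma lintegral_circleMeasure_of_continuousOn {g : ℂ → ℝ≥0∞}
    (hg : ContinuousOn g (Metric.sphere 0 1)) :
    ∫⁻ ζ, g ζ ∂circleMeasure = ENNReal.ofReal (2 * Real.pi)⁻¹ *
      ∫⁻ θ in Ioc 0 (2 * Real.pi), g (circleMap 0 1 θ) := by
  have hmeas : Measurable (circleMap 0 1) := (continuous_circleMap 0 1).measurable
  have hs : MeasurableSet (Metric.sphere (0 : ℂ) 1) := Metric.isClosed_sphere.measurableSet
  set ν := (volume.restrict (Ioc (0 : ℝ) (2 * Real.pi))).map (circleMap 0 1) with hν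
  have hr : ν.restrict (Metric.sphere 0 1) = ν := by
    refine Measure.restrict_eq_self_of_ae_mem ?_
    rw [hν, ae_map_iff (p := (· ∈ Metric.sphere (0 : ℂ) 1)) hmeas.aemeasurable hs]
    exact ae_of_all _ fun θ => circleMap_mem_sphere 0 zero_le_one θ
  have hae : AEMeasurable g ν := by
    rw [← hr]; exact hg.aemeasurable hs
  unfold circleMeasure
  rw [lintegral_smul_measure, lintegral_map' hae hmeas.aemeasurable, smul_eq_mul]

lemma lintegral_circleMeasure_le (g : ℂ → ℝ≥0∞) :
    ∫⁻ ζ, g ζ ∂circleMeasure ≤ ENNReal.ofReal (2 * Real.pi)⁻¹ *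
      ∫⁻ θ in Ioc 0 (2 * Real.pi), g (circleMap 0 1 θ) := by
  unfold circleMeasure
  rw [lintegral_smul_measure, smul_eq_mul]
  gcongr
  exact lintegral_map_le _ _

lemma circleMap_injOn_Ioc : InjOn (circleMap 0 1) (Ioc 0 (2 * Real.pi)) := by
  rw [← uIoc_of_le Real.two_pi_pos.le]
  exact injOn_circleMap_of_abs_sub_le one_ne_zero (by simp [abs_of_pos Real.pi_pos])

/-- P need not define a measurable set, so a Borel subset of full measure is exhibited: the image of
a Borel set of angles under an injective continuous map. -/
lemma ae_circleMeasure_of_ae {P : ℂ → Prop}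
    (h : ∀ᵐ θ ∂volume.restrict (Ioc (0 : ℝ) (2 * Real.pi)), P (circleMap 0 1 θ)) :
    ∀ᵐ ζ ∂circleMeasure, P ζ := by
  have hmeas : Measurable (circleMap 0 1) := (continuous_circleMap 0 1).measurable
  obtain ⟨N, hN, hNm, hN0⟩ := exists_measurable_superset_of_null (ae_iff.1 h)
  set A := circleMap 0 1 '' (Ioc 0 (2 * Real.pi) \ N) with hA
  have hAm : MeasurableSet A := (measurableSet_Ioc.diff hNm).image_of_continuousOn_injOn
    (continuous_circleMap 0 1).continuousOn (circleMap_injOn_Ioc.mono sdiff_subset)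
  have hAP : ∀ ζ ∈ A, P ζ := by
    rintro _ ⟨θ, hθ, rfl⟩
    by_contra hn
    exact hθ.2 (hN hn)
  unfold circleMeasure
  refine Measure.ae_smul_measure ?_ _
  refine (?_ : ∀ᵐ ζ ∂_, ζ ∈ A).mono hAP
  rw [ae_map_iff (p := (· ∈ A)) hmeas.aemeasurable hAm]
  filter_upwards [ae_restrict_mem measurableSet_Ioc, measure_eq_zero_iff_ae_notMem.1 hN0]
    with θ h1 h2
  exact ⟨θ, ⟨h1, h2⟩, rfl⟩

lemma circleMeasure_ne_zero : circleMeasure ≠ 0 := by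
  intro h
  have h1 : circleMeasure univ = 0 := by rw [h]; rfl
  unfold circleMeasure at h1
  rw [Measure.smul_apply, Measure.map_apply (continuous_circleMap 0 1).measurable MeasurableSet.univ]
    at h1
  have := Real.pi_pos
  simp at h1
  have h2 : 0 < Real.pi⁻¹ * 2⁻¹ := by positivity
  rcases h1 with h1 | h1 <;> linarith

end CircleMeasure

/-! ### Boundary values inside the disc. -/

section Conclusion

variable {Ω : ℝ → ℝ} {φ : ℂ → ℂ}

lemma quadPhi_antitone : Antitone (quadPhi Ω) := fun _ _ hxy => by
  unfold quadPhi quadIntegral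
  gcongr

lemma tendsto_quadPhi_top (hΩ : quadIntegral Ω 0 = ∞) :
    Tendsto (quadPhi Ω) (𝓝[>] 0) (𝓝 ∞) := by
  have hU : ⋃ n : ℕ, Ioo (1 / ((n : ℝ) + 1)) 1 = Ioo 0 1 := by
    ext t
    simp only [mem_iUnion, mem_Ioo]
    constructor
    · rintro ⟨n, h1, h2⟩
      exact ⟨lt_trans (by positivity) h1, h2⟩
    · rintro ⟨h1, h2⟩
      obtain ⟨n, hn⟩ := exists_nat_one_div_lt h1
      exact ⟨n, hn, h2⟩
  have hmono : Monotone fun n : ℕ => Ioo (1 / ((n : ℝ) + 1)) 1 := fun n m hnm =>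
    Ioo_subset_Ioo_left (Nat.one_div_le_one_div hnm)
  have hsup : ⨆ n : ℕ, quadIntegral Ω (1 / ((n : ℝ) + 1)) = ∞ := by
    rw [← hΩ]
    unfold quadIntegral
    rw [← hU, setLIntegral_iUnion_of_directed _ hmono.directed_le]
  rw [ENNReal.tendsto_nhds_top_iff_nnreal]
  intro x
  obtain ⟨n, hn⟩ := lt_iSup_iff.1 (hsup.symm ▸ ENNReal.coe_lt_top : (x : ℝ≥0∞) < _)
  filter_upwards [Ioo_mem_nhdsGT (Nat.one_div_pos_of_nat (α := ℝ) (n := n))] with t ht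
  calc (x : ℝ≥0∞) < quadIntegral Ω (1 / ((n : ℝ) + 1)) := hn
    _ ≤ quadPhi Ω (1 / ((n : ℝ) + 1)) := le_add_self
    _ ≤ quadPhi Ω t := quadPhi_antitone ht.2.le

lemma hypDeriv_mean_le {ω : ℝ → ℝ} {p : ℝ} (hφ : IsHolSelfMap φ) (hp : 1 ≤ p) (hΩ : IsGauge Ω)
    (hcont : ContinuousOn Ω (Ioc 0 1)) (hω : IsGauge ω) {r : ℝ} (hr : r ∈ Ioo (0 : ℝ) 1)
    (hmean : ENNReal.ofReal (1 - r) * integralMean (2 * p) (hypDeriv Ω φ) r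
        ≤ ENNReal.ofReal (ω (1 - r))) :
    (∫⁻ θ in Ioc 0 (2 * Real.pi),
        ENNReal.ofReal (hypDeriv Ω φ (r * circleMap 0 1 θ)) ^ (2 * p)) ^ (1 / p)
      ≤ ENNReal.ofReal (2 * Real.pi) ^ (1 / p) *
        ENNReal.ofReal ((ω (1 - r) / (1 - r)) ^ 2) := by
  have hp0 : 0 < p := by linarith
  have hδ : 0 < 1 - r := by linarith [hr.2]
  have hball : ∀ ζ ∈ Metric.sphere (0 : ℂ) 1, (r : ℂ) * ζ ∈ Metric.ball (0 : ℂ) 1 := by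
    intro ζ hζ
    have : ‖ζ‖ = 1 := by simpa using hζ
    simp [this, abs_of_pos hr.1, hr.2]
  have hc : ContinuousOn (fun ζ : ℂ => ENNReal.ofReal |hypDeriv Ω φ (r * ζ)| ^ (2 * p))
      (Metric.sphere 0 1) := by
    have h1 : ContinuousOn (fun ζ : ℂ => hypDeriv Ω φ (r * ζ)) (Metric.sphere 0 1) :=
      (continuousOn_hypDeriv hφ hcont).comp (by fun_prop) hball
    exact ENNReal.continuous_rpow_const.comp_continuousOn
      (ENNReal.continuous_ofReal.comp_continuousOn h1.abs)
  unfold integralMean at hmean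
  rw [lintegral_circleMeasure_of_continuousOn hc] at hmean
  have habs : ∀ θ : ℝ, |hypDeriv Ω φ (r * circleMap 0 1 θ)| = hypDeriv Ω φ (r * circleMap 0 1 θ) :=
    fun θ => abs_of_nonneg (hypDeriv_nonneg hφ hΩ (mul_circleMap_mem_ball ⟨hr.1.le, hr.2⟩ θ))
  simp_rw [habs] at hmean
  set I := ∫⁻ θ in Ioc 0 (2 * Real.pi),
        ENNReal.ofReal (hypDeriv Ω φ (r * circleMap 0 1 θ)) ^ (2 * p) with hI
  have h2 : (ENNReal.ofReal (2 * Real.pi)⁻¹ * I) ^ (1 / (2 * p))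
      ≤ ENNReal.ofReal (ω (1 - r) / (1 - r)) := by
    rw [ENNReal.ofReal_div_of_pos hδ, ENNReal.le_div_iff_mul_le (Or.inl (by simpa using hr.2))
      (Or.inl ENNReal.ofReal_ne_top), mul_comm]
    exact hmean
  have h3 := ENNReal.rpow_le_rpow h2 zero_le_two (z := (2 : ℝ))
  have hω0 : 0 ≤ ω (1 - r) / (1 - r) :=
    div_nonneg (hω _ ⟨hδ, by linarith [hr.1]⟩).le hδ.le
  rw [← ENNReal.rpow_mul, ENNReal.ofReal_rpow_of_nonneg hω0 zero_le_two, Real.rpow_two,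
    show 1 / (2 * p) * 2 = 1 / p by field_simp] at h3
  have h4 : I = ENNReal.ofReal (2 * Real.pi) * (ENNReal.ofReal (2 * Real.pi)⁻¹ * I) := by
    rw [← mul_assoc, ← ENNReal.ofReal_mul Real.two_pi_pos.le,
      mul_inv_cancel₀ Real.two_pi_pos.ne', ENNReal.ofReal_one, one_mul]
  rw [h4, ENNReal.mul_rpow_of_nonneg _ _ (by positivity)]
  gcongr

/-- If the circular means of a majorant of `Φ_Ω ^ p` are bounded, then almost all radial limits lie
inside the disc. -/
lemma ae_hasRadialLimit_norm_lt_one {F : ℝ → ℝ} {p : ℝ} {B : ℝ≥0∞} (hφ : IsHolSelfMap φ)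
    (hp : 1 ≤ p) (hF : ContinuousOn F (Ioo 0 1)) (hF1 : ∀ x ∈ Ioo (0 : ℝ) 1, 1 ≤ F x)
    (hΦ : ∀ x ∈ Ioo (0 : ℝ) 1, quadPhi Ω x ≤ ENNReal.ofReal (8 * F x))
    (hΩ : quadIntegral Ω 0 = ∞) (hB : B < ∞)
    (hbd : ∀ r ∈ Ioo (0 : ℝ) 1, ∫⁻ θ in Ioc 0 (2 * Real.pi),
      ENNReal.ofReal (F (halfDefect (φ (r * circleMap 0 1 θ))) ^ p) ≤ B) :
    ∀ᵐ θ ∂volume.restrict (Ioc (0 : ℝ) (2 * Real.pi)),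
      ∃ w, HasRadialLimit φ (circleMap 0 1 θ) w ∧ ‖w‖ < 1 := by
  have hp0 : 0 < p := by linarith
  set r : ℕ → ℝ := fun n => 1 - 1 / ((n : ℝ) + 2) with hrdef
  have hr : ∀ n, r n ∈ Ioo (0 : ℝ) 1 := by
    intro n
    have h2 : (1 : ℝ) < (n : ℝ) + 2 := by linarith [(Nat.cast_nonneg n : (0 : ℝ) ≤ n)]
    have h0 : (0 : ℝ) < 1 / ((n : ℝ) + 2) := by positivity
    have h1 : 1 / ((n : ℝ) + 2) < 1 := (div_lt_one (by linarith)).2 h2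
    simp only [hrdef]
    constructor <;> linarith
  have hlim : Tendsto r atTop (𝓝[<] 1) := by
    refine tendsto_nhdsWithin_iff.2 ⟨?_, Eventually.of_forall fun n => (hr n).2⟩
    have h1 : Tendsto (fun n : ℕ => (n : ℝ) + 2) atTop atTop :=
      tendsto_atTop_add_const_right _ _ tendsto_natCast_atTop_atTop
    have h2 := (tendsto_inv_atTop_zero.comp h1).const_sub 1
    simpa [hrdef, Function.comp_def] using h2
  have hball : ∀ n θ, (r n : ℂ) * circleMap 0 1 θ ∈ Metric.ball (0 : ℂ) 1 := fun n θ =>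
    mul_circleMap_mem_ball ⟨(hr n).1.le, (hr n).2⟩ θ
  have hX : ∀ n θ, halfDefect (φ (r n * circleMap 0 1 θ)) ∈ Ioo (0 : ℝ) 1 := fun n θ =>
    halfDefect_mem (hφ.2 (hball n θ))
  set v : ℕ → ℝ → ℝ≥0∞ := fun n θ =>
    ENNReal.ofReal (F (halfDefect (φ (r n * circleMap 0 1 θ))) ^ p) with hv
  have hvm : ∀ n, Measurable (v n) := by
    intro n
    have c1 : Continuous fun θ : ℝ => φ (r n * circleMap 0 1 θ) :=
      hφ.1.continuousOn.comp_continuous (by fun_prop) (hball n)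
    have c2 : Continuous fun θ : ℝ => F (halfDefect (φ (r n * circleMap 0 1 θ))) :=
      hF.comp_continuous (continuous_halfDefect.comp c1) (hX n)
    exact (c2.measurable.pow_const p).ennreal_ofReal
  -- By Fatou's lemma the liminf is finite for almost every θ, whereas |w| = 1 would send
  -- `halfDefect` to 0, hence Φ and `v n θ` to infinity.
  have hfatou : ∫⁻ θ in Ioc 0 (2 * Real.pi), liminf (fun n => v n θ) atTop ≠ ∞ := by
    refine ((lintegral_liminf_le hvm).trans_lt ?_).ne
    refine lt_of_le_of_lt ?_ hB
    refine liminf_le_of_frequently_le' (Frequently.of_forall fun n => hbd _ (hr n))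
  have hfin := ae_lt_top (Measurable.liminf hvm) hfatou
  filter_upwards [hfin, ae_restrict_of_ae (ae_exists_hasRadialLimit hφ)] with θ h1 ⟨w, hw⟩
  refine ⟨w, hw, ?_⟩
  have hseq : Tendsto (fun n => φ (r n * circleMap 0 1 θ)) atTop (𝓝 w) := hw.comp hlim
  have hle : ‖w‖ ≤ 1 := le_of_tendsto hseq.norm (Eventually.of_forall fun n => by
    have := hφ.2 (hball n θ)
    simpa using (Metric.ball_subset_closedBall this))
  refine lt_of_le_of_ne hle fun hw1 => h1.ne ?_
  have hX0 : Tendsto (fun n => halfDefect (φ (r n * circleMap 0 1 θ))) atTop (𝓝[>] 0) := by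
    refine tendsto_nhdsWithin_iff.2 ⟨?_, Eventually.of_forall fun n => (hX n θ).1⟩
    have := (continuous_halfDefect.tendsto w).comp hseq
    simpa [halfDefect, hw1, Function.comp_def] using this
  have h2 := (tendsto_quadPhi_top hΩ).comp hX0
  have h3 : Tendsto (fun n => quadPhi Ω (halfDefect (φ (r n * circleMap 0 1 θ))) ^ p) atTop (𝓝 ∞) := by
    have := (ENNReal.continuous_rpow_const (y := p)).tendsto ∞
    rw [ENNReal.top_rpow_of_pos hp0] at this
    exact this.comp h2
  have h4 : ∀ n, quadPhi Ω (halfDefect (φ (r n * circleMap 0 1 θ))) ^ p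
      ≤ ENNReal.ofReal 8 ^ p * v n θ := by
    intro n
    have hx := hX n θ
    have hF0 : 0 ≤ F (halfDefect (φ (r n * circleMap 0 1 θ))) := by linarith [hF1 _ hx]
    refine (ENNReal.rpow_le_rpow (hΦ _ hx) hp0.le).trans_eq ?_
    rw [ENNReal.ofReal_mul (by norm_num), ENNReal.mul_rpow_of_nonneg _ _ hp0.le, hv,
      ENNReal.ofReal_rpow_of_nonneg hF0 hp0.le]
  have h5 : Tendsto (fun n => ENNReal.ofReal 8 ^ p * v n θ) atTop (𝓝 ∞) :=
    tendsto_nhds_top_mono' h3 h4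
  have hc : ENNReal.ofReal 8 ^ p ≠ ∞ := ENNReal.rpow_ne_top_of_nonneg hp0.le ENNReal.ofReal_ne_top
  have hc0 : ENNReal.ofReal 8 ^ p ≠ 0 := by
    simp [ENNReal.rpow_eq_zero_iff, hp0.not_gt]
  have h6 : Tendsto (fun n => v n θ) atTop (𝓝 ∞) := by
    have := ENNReal.Tendsto.const_mul (a := (ENNReal.ofReal 8 ^ p)⁻¹) h5 (Or.inl ENNReal.top_ne_zero)
    simp_rw [← mul_assoc, ENNReal.inv_mul_cancel hc0 hc, one_mul] at this
    rwa [ENNReal.mul_top (ENNReal.inv_ne_zero.2 hc)] at this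
  exact h6.liminf_eq

end Conclusion

theorem mainTheorem7 (ω Ω : ℝ → ℝ) (φ : ℂ → ℂ) (p ε : ℝ)
    (hφ : IsHolSelfMap φ) (hp : 1 ≤ p)
    (hω_pos : IsGauge ω) (hω_mono : MonotoneOn ω (Ioc 0 1))
    (hΩ_pos : IsGauge Ω) (hΩ_mono : MonotoneOn Ω (Ioc 0 1))
    (hε : 0 < ε) (hΩ_anti : AntitoneOn (fun t : ℝ => Ω t / t ^ (1 - ε)) (Ioc 0 1))
    (hω_int : quadIntegral ω 0 < ∞) (hΩ_int : quadIntegral Ω 0 = ∞)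
    (hmean : ∀ r ∈ Ioo (0 : ℝ) 1,
      ENNReal.ofReal (1 - r) * integralMean (2 * p) (hypDeriv Ω φ) r
        ≤ ENNReal.ofReal (ω (1 - r))) :
    (⨆ r ∈ Ioo (0 : ℝ) 1, ∫⁻ ζ, quadPhi Ω (1 - ‖φ (r * ζ)‖) ^ p ∂circleMeasure) < ∞ ∧
    (∀ᵐ ζ ∂circleMeasure, ∃ w, HasRadialLimit φ ζ w ∧ ‖w‖ < 1) ∧
    ¬ IsInner φ := by
  have hp0 : 0 < p := by linarith
  have hanti := hΩ_pos.div_antitoneOn hε hΩ_anti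
  have hcont := continuousOn_of_monotoneOn_of_div_antitoneOn hΩ_mono hanti
  obtain ⟨F, K₁, K₂, C, hC, hF, hK₂, hK, hK₁, hF1, hΦ, hlap⟩ :=
    exists_rpow_majorant hp hΩ_pos hΩ_mono hanti
  obtain ⟨B, hB, hbd⟩ := exists_circularMean_bound hφ hp hΩ_pos hΩ_mono hcont hC hF hK₂ hK hK₁ hF1
    hlap hω_int (ENNReal.rpow_ne_top_of_nonneg (by positivity) ENNReal.ofReal_ne_top)
    fun r hr => hypDeriv_mean_le hφ hp hΩ_pos hcont hω_pos hr (hmean r hr)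
  have hae := ae_circleMeasure_of_ae (P := fun ζ => ∃ w, HasRadialLimit φ ζ w ∧ ‖w‖ < 1)
    (ae_hasRadialLimit_norm_lt_one hφ hp hF hF1 hΦ hΩ_int hB hbd)
  refine ⟨?_, hae, fun hinner => ?_⟩
  · refine lt_of_le_of_lt (iSup₂_le (a := ENNReal.ofReal (2 * Real.pi)⁻¹ *
      (ENNReal.ofReal 8 ^ p * B)) fun r hr => ?_) ?_
    · refine (lintegral_circleMeasure_le _).trans ?_
      gcongr
      refine le_trans ?_ (mul_le_mul_right (hbd r hr) _)
      rw [← lintegral_const_mul' _ _ (ENNReal.rpow_ne_top_of_nonneg hp0.le ENNReal.ofReal_ne_top)]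
      refine lintegral_mono fun θ => ?_
      have hb := hφ.2 (mul_circleMap_mem_ball ⟨hr.1.le, hr.2⟩ θ)
      have hx := halfDefect_mem hb
      have hF0 : 0 ≤ F (halfDefect (φ (r * circleMap 0 1 θ))) := by linarith [hF1 _ hx]
      calc _ ≤ quadPhi Ω (halfDefect (φ (r * circleMap 0 1 θ))) ^ p :=
            ENNReal.rpow_le_rpow (quadPhi_antitone (halfDefect_le hb)) hp0.le
        _ ≤ ENNReal.ofReal (8 * F (halfDefect (φ (r * circleMap 0 1 θ)))) ^ p :=
            ENNReal.rpow_le_rpow (hΦ _ hx) hp0.le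
        _ = _ := by
            rw [ENNReal.ofReal_mul (by norm_num), ENNReal.mul_rpow_of_nonneg _ _ hp0.le,
              ENNReal.ofReal_rpow_of_nonneg hF0 hp0.le]
    · exact ENNReal.mul_lt_top ENNReal.ofReal_lt_top (ENNReal.mul_lt_top
        (ENNReal.rpow_lt_top_of_nonneg hp0.le ENNReal.ofReal_ne_top) hB)
  · have hfalse : ∀ᵐ ζ ∂circleMeasure, False := by
      filter_upwards [hae, hinner.2] with ζ ⟨w, hw, hw1⟩ ⟨w', hw', hw1'⟩
      rw [tendsto_nhds_unique hw hw'] at hw1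
      linarith
    exact circleMeasure_ne_zero (ae_eq_bot.1 (eventually_false_iff_eq_bot.1 hfalse))
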